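/- Let $p$ and $q$ be two different primes, let $n\ge 1$ be an integer, and put $N=p^nq^2$ and $\xi_N=e^{2\pi i/N}$. Then Fuglede's conjecture holds for the cyclic group $\mathbb{Z}_N$: a non-empty subset $S\subseteq\mathbb{Z}_N$ is spectral if and only if it tiles $\mathbb{Z}_N$. Here $S$ is called spectral if there is a set $\Lambda\subseteq\mathbb{Z}_N$ such that every function $f:S\to\mathbb{C}$ is a $\mathbb{C}$-linear combination of the exponentials $x\mapsto \xi_N^{\lambda x}$, $\lambda\in\Lambda$, and $$\sum_{x\in S}\xi_N^{(\lambda-\lambda')x}=0\qquad\text{for all } \lambda,\lambda'\in\Lambda,\ \lambda\ne\lambda'.$$ The set $S$ tiles $\mathbb{Z}_N$ if there is a set $T\subseteq\mathbb{Z}_N$ such that every element of $\mathbb{Z}_N$ can be written in exactly one way as $s+t$ with $s\in S$ and $t\in T$. -/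

import Mathlib

namespace Fuglede

/-- The exponential `χ_l(x) = ξ_N ^ (l * x)`, with `ξ_N = exp (2πi / N)` and the product `l * x`
taken modulo `N`, restricted to the set `S`. -/
noncomputable def expOn {N : ℕ} [NeZero N] (S : Finset (ZMod N)) (l : ZMod N) : S → ℂ :=
  fun x => ZMod.stdAddChar (l * (x : ZMod N))

/-- `S ⊆ ℤ/N` is spectral: for some `Λ ⊆ ℤ/N` the exponentials `χ_l`, `l ∈ Λ`, restricted to `S`,
form an orthogonal basis of `L²(S)`, that is, they span all functions `S → ℂ` and
`∑ x ∈ S, ξ_N ^ ((l - l') * x) = 0` for any two different `l, l' ∈ Λ`. -/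
def IsSpectral {N : ℕ} [NeZero N] (S : Finset (ZMod N)) : Prop :=
  ∃ Λ : Finset (ZMod N),
    Submodule.span ℂ (expOn S '' (Λ : Set (ZMod N))) = ⊤ ∧
    ∀ l ∈ Λ, ∀ l' ∈ Λ, l ≠ l' → ∑ x ∈ S, (ZMod.stdAddChar ((l - l') * x) : ℂ) = 0

/-- `S` tiles the abelian group `G`: for some `T ⊆ G` every element of `G` can be written
in exactly one way as `s + t` with `s ∈ S` and `t ∈ T`. -/
def Tiles {G : Type*} [AddCommGroup G] (S : Set G) : Prop :=
  ∃ T : Set G, ∀ g : G, ∃! st : G × G, st.1 ∈ S ∧ st.2 ∈ T ∧ st.1 + st.2 = g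

end Fuglede

/-! Subsets of ℤ/N are represented by finite sets of integers, and everything is read off from the
orders `d ∣ N` at which the exponential sum of a set vanishes, that is, from the cyclotomic divisors
of its mask polynomial. Such sums are Galois invariant (`sum_chr_mul_eq_zero`), so a difference of
two points of a spectrum matters only through its order in ℤ/N. Fourier inversion turns vanishing
into statements on residue counts: at `p ^ (i + 1)` a class modulo `p ^ i` splits evenly
(`cnt_shift_of_vanishes_prime_pow`), and at an order divisible by both primes the counts have zero
mixed second differences (`cnt_grid_of_vanishes`).

Spectral implies tile, by induction on the exponents of `p ^ n * q ^ m` with `m ≤ 2`. If the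
spectrum lies in one class modulo a prime, or the set is periodic under a subgroup of prime order,
the problem descends to a smaller group (`exists_tilePair_of_spectrum_coset`,
`exists_tilePair_of_periodic`). If `q ^ m` divides the cardinality, a complement is written down
digit by digit (`exists_tilePair_of_dvd_card`). Otherwise the set vanishes at order `N` and contains
cosets of the subgroups of orders `p` and `q`, so its spectrum is equidistributed modulo both
primes. For `m = 1` this contradicts the failed divisibility. For `m = 2` it forces any two elements
of the spectrum congruent modulo `q` to be congruent modulo `q ^ 2` (`exists_tilePair_of_fiber`),
and then an explicit complement exists again (`exists_tilePair_of_differences`).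

Tile implies spectral, for all exponents, goes through the Coven–Meyerowitz conditions. The
cardinality condition is `TilePair.card_eq`. The product condition `TilePair.condT2` follows by
induction, because one of the two factors of a tiling lies in a single class modulo `p` or `q`
(`TilePair.coset`). The two conditions make an explicit set of digit expansions a spectrum. -/

namespace Fuglede

open Finset

/-! ### Characters and vanishing exponential sums -/

/-- The additive character `x ↦ exp (2πi x / N)` of `ℤ`. -/
noncomputable def chr (N : ℕ) (x : ℤ) : ℂ := Complex.exp (2 * Real.pi * Complex.I * x / N)

lemma chr_add (N : ℕ) (x y : ℤ) : chr N (x + y) = chr N x * chr N y := by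
  rw [chr, chr, chr, ← Complex.exp_add]
  congr 1
  push_cast
  ring

@[simp] lemma chr_zero (N : ℕ) : chr N 0 = 1 := by simp [chr]

lemma chr_ne_zero (N : ℕ) (x : ℤ) : chr N x ≠ 0 := Complex.exp_ne_zero _

lemma chr_sub (N : ℕ) (x y : ℤ) : chr N (x - y) = chr N x / chr N y := by
  rw [eq_div_iff (chr_ne_zero N y), ← chr_add, sub_add_cancel]

lemma chr_eq_one_iff {N : ℕ} (hN : N ≠ 0) (x : ℤ) : chr N x = 1 ↔ (N : ℤ) ∣ x := by
  have hN' : (N : ℂ) ≠ 0 := Nat.cast_ne_zero.mpr hN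
  have h2 : (2 * Real.pi * Complex.I : ℂ) ≠ 0 := Complex.two_pi_I_ne_zero
  rw [chr, Complex.exp_eq_one_iff]
  constructor
  · rintro ⟨k, hk⟩
    refine ⟨k, ?_⟩
    rw [div_eq_iff hN'] at hk
    have : (x : ℂ) = N * k := by
      apply mul_left_cancel₀ h2
      rw [hk]; ring
    exact_mod_cast this
  · rintro ⟨k, rfl⟩
    refine ⟨k, ?_⟩
    push_cast
    field_simp

lemma chr_congr {N : ℕ} (hN : N ≠ 0) {x y : ℤ} (h : (N : ℤ) ∣ x - y) : chr N x = chr N y := by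
  have := (chr_eq_one_iff hN _).2 h
  rwa [chr_sub, div_eq_one_iff_eq (chr_ne_zero N y)] at this

lemma chr_mul_right {M K : ℕ} (hK : K ≠ 0) (x : ℤ) : chr (M * K) (K * x) = chr M x := by
  have hK' : (K : ℂ) ≠ 0 := Nat.cast_ne_zero.mpr hK
  rw [chr, chr]
  congr 1
  push_cast
  rw [mul_comm (M : ℂ), mul_left_comm, mul_div_mul_left _ _ hK']

lemma chr_nat_mul (N k : ℕ) (x : ℤ) : chr N (k * x) = chr N x ^ k := by
  rw [chr, chr, ← Complex.exp_nat_mul]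
  congr 1
  push_cast
  ring

lemma isPrimitiveRoot_chr {N : ℕ} (hN : N ≠ 0) : IsPrimitiveRoot (chr N 1) N := by
  have := Complex.isPrimitiveRoot_exp N hN
  simpa [chr] using this

lemma sum_range_chr {d : ℕ} (hd : d ≠ 0) (x : ℤ) :
    ∑ l ∈ range d, chr d (l * x) = if (d : ℤ) ∣ x then (d : ℂ) else 0 := by
  simp_rw [chr_nat_mul]
  split_ifs with h
  · simp [(chr_eq_one_iff hd x).2 h]
  · have h1 : chr d x ≠ 1 := fun h' => h ((chr_eq_one_iff hd x).1 h')
    have h2 := mul_neg_geom_sum (chr d x) d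
    rw [← chr_nat_mul, (chr_eq_one_iff hd _).2 (dvd_mul_right _ _), sub_self] at h2
    exact (mul_eq_zero.1 h2).resolve_left (sub_ne_zero.2 (Ne.symm h1))

/-- The mask polynomial of `A` is divisible by the `d`-th cyclotomic polynomial. -/
def Vanishes (A : Finset ℤ) (d : ℕ) : Prop := ∑ a ∈ A, chr d a = 0

/-- Galois invariance: the primitive `d`-th roots of unity share one minimal polynomial, so an
integer polynomial that kills one of them kills all. -/
lemma sum_chr_mul_eq_zero {A : Finset ℤ} {d : ℕ} (hd : d ≠ 0) {u v : ℤ} (hu : IsCoprime u d)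
    (hv : IsCoprime v d) (h : ∑ a ∈ A, chr d (u * a) = 0) : ∑ a ∈ A, chr d (v * a) = 0 := by
  have hd0 : (d : ℤ) ≠ 0 := by exact_mod_cast hd
  obtain ⟨w, hw⟩ : ∃ w : ℕ, (d : ℤ) ∣ w - v ∧ IsCoprime (w : ℤ) d := by
    refine ⟨(v % d).toNat, ?_⟩
    rw [Int.toNat_of_nonneg (Int.emod_nonneg _ hd0)]
    have hdv : (d : ℤ) ∣ v % d - v :=
      ⟨-(v / d), by linarith [Int.emod_add_mul_ediv v d]⟩
    refine ⟨hdv, ?_⟩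
    obtain ⟨k, hk⟩ := hdv
    rw [show v % (d : ℤ) = v + d * k by linarith]
    exact hv.add_mul_left_left k
  -- `t` inverts `u` modulo `d`, so the power `t * w` carries the root attached to `u` to the one
  -- attached to `v`.
  obtain ⟨t, ht⟩ : ∃ t : ℕ, (d : ℤ) ∣ u * t - 1 ∧ IsCoprime (t : ℤ) d := by
    obtain ⟨a, b, hab⟩ := hu
    have ha : (d : ℤ) ∣ (a % d) - a :=
      ⟨-(a / d), by linarith [Int.emod_add_mul_ediv a d]⟩
    refine ⟨(a % d).toNat, ?_⟩
    rw [Int.toNat_of_nonneg (Int.emod_nonneg _ hd0)]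
    obtain ⟨k, hk⟩ := ha
    have h2 : u * (a % d) - 1 = d * (u * k - b) := by
      rw [show a % (d : ℤ) = a + d * k by linarith]; linear_combination hab
    exact ⟨⟨_, h2⟩, ⟨u, -(u * k - b), by linear_combination h2⟩⟩
  have hexp : ∀ (x : ℤ), chr d x = chr d 1 ^ (x % d).toNat := by
    intro x
    rw [← chr_nat_mul, mul_one, Int.toNat_of_nonneg (Int.emod_nonneg _ hd0)]
    exact chr_congr hd ⟨x / d, by linarith [Int.emod_add_mul_ediv x d]⟩
  set P : Polynomial ℤ := ∑ a ∈ A, Polynomial.X ^ ((u * a) % d).toNat with hP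
  have hprim := isPrimitiveRoot_chr hd
  have h0 : Polynomial.aeval (chr d 1) P = 0 := by
    rw [hP, map_sum, ← h]
    refine sum_congr rfl fun a _ => ?_
    rw [map_pow, Polynomial.aeval_X, hexp (u * a)]
  have hdvd := minpoly.isIntegrallyClosed_dvd (hprim.isIntegral (Nat.pos_of_ne_zero hd)) h0
  have hcop : (t * w).Coprime d := by
    rw [← Nat.isCoprime_iff_coprime]
    push_cast
    exact ht.2.mul_left hw.2
  rw [hprim.minpoly_eq_pow_coprime hcop] at hdvd
  obtain ⟨Q, hQ⟩ := hdvd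
  have h1 : Polynomial.aeval (chr d 1 ^ (t * w)) P = 0 := by
    rw [hQ, map_mul, minpoly.aeval, zero_mul]
  rw [← h1, hP, map_sum]
  refine sum_congr rfl fun a _ => ?_
  rw [map_pow, Polynomial.aeval_X, ← pow_mul, mul_comm (t * w), pow_mul, ← hexp, ← chr_nat_mul]
  apply chr_congr hd
  obtain ⟨x, hx⟩ := ht.1
  obtain ⟨y, hy⟩ := hw.1
  refine ⟨-(y * a) - x * w * a, ?_⟩
  push_cast
  linear_combination (-a) * hy - w * a * hx

lemma vanishes_iff_mul {A : Finset ℤ} {d : ℕ} (hd : d ≠ 0) {u : ℤ} (hu : IsCoprime u d) :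
    Vanishes A d ↔ ∑ a ∈ A, chr d (u * a) = 0 := by
  have h1 : IsCoprime (1 : ℤ) d := isCoprime_one_left
  have h : Vanishes A d ↔ ∑ a ∈ A, chr d (1 * a) = 0 := by simp [Vanishes]
  rw [h]
  exact ⟨sum_chr_mul_eq_zero hd h1 hu, sum_chr_mul_eq_zero hd hu h1⟩

lemma vanishes_of_factor {A : Finset ℤ} {M K : ℕ} (hM : M ≠ 0) (hK : K ≠ 0) {x u : ℤ}
    (hx : x = K * u) (hu : IsCoprime u M) (h : ∑ a ∈ A, chr (M * K) (x * a) = 0) :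
    Vanishes A M := by
  rw [vanishes_iff_mul hM hu, ← h]
  refine sum_congr rfl fun a _ => ?_
  rw [hx, mul_assoc, chr_mul_right hK]

lemma vanishes_factor_iff {A : Finset ℤ} {M K : ℕ} (hM : M ≠ 0) (hK : K ≠ 0) {x u : ℤ}
    (hx : x = K * u) (hu : IsCoprime u M) :
    Vanishes A M ↔ ∑ a ∈ A, chr (M * K) (x * a) = 0 := by
  rw [vanishes_iff_mul hM hu]
  refine Eq.congr_left (sum_congr rfl fun a _ => ?_)
  rw [hx, mul_assoc, chr_mul_right hK]

/-! ### Residue counts and their Fourier expansion -/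

/-- The number of elements of `A` congruent to `r` modulo `M`. -/
def cnt (A : Finset ℤ) (M : ℕ) (r : ℤ) : ℕ := #{a ∈ A | (M : ℤ) ∣ a - r}

lemma cnt_congr (A : Finset ℤ) {M : ℕ} {r s : ℤ} (h : (M : ℤ) ∣ r - s) : cnt A M r = cnt A M s := by
  unfold cnt
  congr 1
  refine filter_congr fun a _ => ?_
  rw [show a - s = (a - r) + (r - s) by ring]
  exact (dvd_add_left h).symm

lemma cnt_pos {A : Finset ℤ} {M : ℕ} {r : ℤ} : 0 < cnt A M r ↔ ∃ a ∈ A, (M : ℤ) ∣ a - r := by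
  simp [cnt, card_pos, Finset.Nonempty]

lemma cnt_self_pos {A : Finset ℤ} {a : ℤ} (ha : a ∈ A) (M : ℕ) : 0 < cnt A M a :=
  cnt_pos.2 ⟨a, ha, by simp⟩

lemma mul_cnt (A : Finset ℤ) {d : ℕ} (hd : d ≠ 0) (r : ℤ) :
    (d : ℂ) * cnt A d r = ∑ l ∈ range d, chr d (-(l * r)) * ∑ a ∈ A, chr d (l * a) := by
  have h1 : ∀ l : ℕ, chr d (-(l * r)) * ∑ a ∈ A, chr d (l * a) =
      ∑ a ∈ A, chr d (l * (a - r)) := by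
    intro l
    rw [mul_sum]
    refine sum_congr rfl fun a _ => ?_
    rw [← chr_add]
    ring_nf
  simp_rw [h1]
  rw [sum_comm]
  simp_rw [sum_range_chr hd]
  rw [cnt, card_filter]
  push_cast
  rw [mul_sum]
  simp

/-- In the expansion `mul_cnt` the frequencies prime to `p` drop out, and those divisible by `p` do
not see a shift by `p ^ i`. -/
lemma cnt_shift_of_vanishes_prime_pow {p : ℕ} (hp : p.Prime) {i : ℕ} {A : Finset ℤ}
    (h : Vanishes A (p ^ (i + 1))) (r k : ℤ) :
    cnt A (p ^ (i + 1)) (r + k * p ^ i) = cnt A (p ^ (i + 1)) r := by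
  have hd : p ^ (i + 1) ≠ 0 := pow_ne_zero _ hp.ne_zero
  have hd' : ((p ^ (i + 1) : ℕ) : ℂ) ≠ 0 := Nat.cast_ne_zero.2 hd
  have : ((p ^ (i + 1) : ℕ) : ℂ) * cnt A (p ^ (i + 1)) (r + k * p ^ i) =
      ((p ^ (i + 1) : ℕ) : ℂ) * cnt A (p ^ (i + 1)) r := by
    rw [mul_cnt A hd, mul_cnt A hd]
    refine sum_congr rfl fun l _ => ?_
    by_cases hl : p ∣ l
    · congr 1
      apply chr_congr hd
      obtain ⟨m, rfl⟩ := hl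
      exact ⟨-(m * k), by push_cast; ring⟩
    · have hc : IsCoprime (l : ℤ) (p ^ (i + 1) : ℕ) := by
        rw [Nat.isCoprime_iff_coprime]
        exact Nat.Coprime.pow_right _ ((Nat.Prime.coprime_iff_not_dvd hp).2 hl).symm
      rw [(vanishes_iff_mul hd hc).1 h, mul_zero, mul_zero]
  exact_mod_cast mul_left_cancel₀ hd' this

/-- Frequencies divisible by `p` do not see the shift by `P`, those divisible by `q` do not see the
shift by `Q`, and the remaining ones are prime to `M` and carry coefficient zero. Hence every mixed
second difference of the counts is zero. -/
lemma cnt_grid_of_vanishes {p q P Q M : ℕ} (hM0 : M ≠ 0)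
    (hP : M = p * P) (hQ : M = q * Q) (hM : ∀ l : ℕ, ¬ p ∣ l → ¬ q ∣ l → l.Coprime M)
    {A : Finset ℤ} (h : Vanishes A M) (r k l : ℤ) :
    cnt A M r + cnt A M (r + k * P + l * Q) = cnt A M (r + k * P) + cnt A M (r + l * Q) := by
  have hd' : (M : ℂ) ≠ 0 := Nat.cast_ne_zero.2 hM0
  have : (M : ℂ) * cnt A M r + M * cnt A M (r + k * P + l * Q) =
      M * cnt A M (r + k * P) + M * cnt A M (r + l * Q) := by
    simp_rw [mul_cnt A hM0]
    rw [← sum_add_distrib, ← sum_add_distrib]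
    refine sum_congr rfl fun j _ => ?_
    by_cases hj : p ∣ j
    · have h1 : ∀ s : ℤ, chr M (-(j * (s + k * P))) = chr M (-(j * s)) := by
        intro s
        apply chr_congr hM0
        obtain ⟨m, rfl⟩ := hj
        exact ⟨-(m * k), by rw [hP]; push_cast; ring⟩
      rw [h1, show r + k * P + l * Q = (r + l * Q) + k * P by ring, h1]
    by_cases hj' : q ∣ j
    · have h1 : ∀ s : ℤ, chr M (-(j * (s + l * Q))) = chr M (-(j * s)) := by
        intro s
        apply chr_congr hM0
        obtain ⟨m, rfl⟩ := hj'
        exact ⟨-(m * l), by rw [hQ]; push_cast; ring⟩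
      rw [h1, h1, add_comm]
    · have hc : IsCoprime (j : ℤ) M := by
        rw [Nat.isCoprime_iff_coprime]
        exact hM j hj hj'
      simp [(vanishes_iff_mul hM0 hc).1 h]
  rw [← mul_add, ← mul_add] at this
  exact_mod_cast mul_left_cancel₀ hd' this

lemma cnt_eq_sum {A : Finset ℤ} {M K : ℕ} (hM : M ≠ 0) (hK : K ≠ 0) (r : ℤ) :
    cnt A M r = ∑ k ∈ range K, cnt A (M * K) (r + k * M) := by
  have hM' : (M : ℤ) ≠ 0 := by exact_mod_cast hM
  have hK' : (K : ℤ) ≠ 0 := by exact_mod_cast hK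
  unfold cnt
  rw [card_eq_sum_card_fiberwise (f := fun a => (((a - r) / M) % K).toNat) (t := range K)]
  · refine sum_congr rfl fun k hk => ?_
    rw [filter_filter]
    congr 1
    refine filter_congr fun a _ => ?_
    constructor
    · rintro ⟨⟨m, hm⟩, h2⟩
      rw [hm, Int.mul_ediv_cancel_left _ hM'] at h2
      have h3 : m % K = k := by
        rw [← h2, Int.toNat_of_nonneg (Int.emod_nonneg _ hK')]
      refine ⟨m / K, ?_⟩
      push_cast
      have := Int.emod_add_mul_ediv m K
      rw [h3] at this
      linear_combination hm - M * this
    · rintro ⟨m, hm⟩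
      push_cast at hm
      have h4 : a - r = M * (k + K * m) := by linear_combination hm
      refine ⟨⟨_, h4⟩, ?_⟩
      rw [h4, Int.mul_ediv_cancel_left _ hM', Int.add_mul_emod_self_left,
        Int.emod_eq_of_lt (by positivity) (by exact_mod_cast mem_range.1 hk), Int.toNat_natCast]
  · intro a _
    simp only [coe_range, Set.mem_Iio]
    have := Int.emod_lt_of_pos ((a - r) / M) (b := K) (by positivity)
    have := Int.emod_nonneg ((a - r) / M) hK'
    omega

lemma card_eq_sum_cnt {A : Finset ℤ} {K : ℕ} (hK : K ≠ 0) :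
    #A = ∑ k ∈ range K, cnt A K k := by
  have := cnt_eq_sum (A := A) one_ne_zero hK 0
  simpa [cnt] using this

lemma cnt_eq_mul_of_vanishes {p : ℕ} (hp : p.Prime) {i : ℕ} {A : Finset ℤ}
    (h : Vanishes A (p ^ (i + 1))) (r : ℤ) :
    cnt A (p ^ i) r = p * cnt A (p ^ (i + 1)) r := by
  rw [cnt_eq_sum (pow_ne_zero i hp.ne_zero) hp.ne_zero]
  rw [← pow_succ]
  push_cast
  rw [sum_congr rfl fun (k : ℕ) _ => cnt_shift_of_vanishes_prime_pow hp h r (k : ℤ)]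
  simp

lemma card_eq_mul_cnt {p : ℕ} (hp : p.Prime) {A : Finset ℤ} (h : Vanishes A p) (r : ℤ) :
    #A = p * cnt A p r := by
  have := cnt_eq_mul_of_vanishes hp (i := 0) (by simpa using h) r
  simpa [cnt] using this

-- Each level at which `A` vanishes contributes one factor `p`, because the class splits evenly
-- there; at any other level the count is only a sum of counts already divisible by the required
-- power.
open Classical in
lemma pow_card_dvd_cnt {p : ℕ} (hp : p.Prime) (A : Finset ℤ) (n i : ℕ) (r : ℤ) :
    p ^ #{j ∈ range n | Vanishes A (p ^ (i + j + 1))} ∣ cnt A (p ^ i) r := by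
  induction n generalizing i r with
  | zero => simp
  | succ n ih =>
    have hsplit : #{j ∈ range (n + 1) | Vanishes A (p ^ (i + j + 1))} =
        #{j ∈ range n | Vanishes A (p ^ (i + 1 + j + 1))} +
          if Vanishes A (p ^ (i + 1)) then 1 else 0 := by
      simp only [card_filter]
      rw [sum_range_succ']
      simp only [add_zero]
      congr 1
      refine sum_congr rfl fun j _ => ?_
      rw [show i + (j + 1) + 1 = i + 1 + j + 1 by ring]
    rw [hsplit]
    split_ifs with h
    · rw [cnt_eq_mul_of_vanishes hp h, pow_succ, mul_comm]
      exact mul_dvd_mul_left _ (ih _ _)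
    · rw [cnt_eq_sum (pow_ne_zero i hp.ne_zero) hp.ne_zero, ← pow_succ, add_zero]
      exact dvd_sum fun k _ => ih _ _

open Classical in
lemma pow_card_dvd_card {p : ℕ} (hp : p.Prime) (A : Finset ℤ) (n : ℕ) :
    p ^ #{j ∈ range n | Vanishes A (p ^ (j + 1))} ∣ #A := by
  have := pow_card_dvd_cnt hp A n 0 0
  simpa [cnt] using this

/-! ### Valuations of differences and digit sets -/

/-- `p ^ δ` is the exact power of `p` dividing `x`. -/
def ExactPow (p δ : ℕ) (x : ℤ) : Prop := (p : ℤ) ^ δ ∣ x ∧ ¬ (p : ℤ) ^ (δ + 1) ∣ x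

lemma exists_exactPow {p n : ℕ} {x : ℤ} (h : ¬ (p : ℤ) ^ n ∣ x) : ∃ δ < n, ExactPow p δ x := by
  induction n with
  | zero => simp at h
  | succ n ih =>
    by_cases h' : (p : ℤ) ^ n ∣ x
    · exact ⟨n, n.lt_succ_self, h', h⟩
    · obtain ⟨δ, hδ, h2⟩ := ih h'
      exact ⟨δ, hδ.trans n.lt_succ_self, h2⟩

lemma ExactPow.eq_mul {p δ : ℕ} {x : ℤ} (h : ExactPow p δ x) :
    ∃ u : ℤ, x = p ^ δ * u ∧ ¬ (p : ℤ) ∣ u := by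
  obtain ⟨⟨u, rfl⟩, h2⟩ := h
  refine ⟨u, rfl, fun h => h2 ?_⟩
  rw [pow_succ]
  exact mul_dvd_mul_left _ h

lemma ExactPow.not_dvd {p δ n : ℕ} {x : ℤ} (h : ExactPow p δ x) (hδ : δ < n) :
    ¬ (p : ℤ) ^ n ∣ x :=
  fun h' => h.2 ((pow_dvd_pow _ hδ).trans h')

lemma ExactPow.unique {p δ ε : ℕ} {x : ℤ} (h : ExactPow p δ x) (h' : ExactPow p ε x) : δ = ε := by
  rcases lt_trichotomy δ ε with hlt | rfl | hlt
  · exact absurd h'.1 (h.not_dvd hlt)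
  · rfl
  · exact absurd h.1 (h'.not_dvd hlt)

lemma ExactPow.add_of_dvd {p δ n : ℕ} {x y : ℤ} (h : ExactPow p δ x) (hδ : δ < n)
    (hy : (p : ℤ) ^ n ∣ y) : ExactPow p δ (x + y) :=
  ⟨dvd_add h.1 ((pow_dvd_pow _ hδ.le).trans hy),
    fun h' => h.2 ((dvd_add_left ((pow_dvd_pow _ hδ).trans hy)).1 h')⟩

lemma ExactPow.mul_left {p δ : ℕ} (hp : p.Prime) {x c : ℤ} (h : ExactPow p δ x)
    (hc : ¬ (p : ℤ) ∣ c) : ExactPow p δ (c * x) := by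
  have hp' : Prime (p : ℤ) := Nat.prime_iff_prime_int.1 hp
  refine ⟨h.1.mul_left c, fun h' => h.2 ?_⟩
  exact hp'.pow_dvd_of_dvd_mul_left _ hc h'

/-- The base-`p` digits at the places in `Δ` separate the points of `B`, since two of them first
differ at a place in `Δ`. -/
lemma card_le_pow_of_exactPow {p : ℕ} (hp : p.Prime) {B : Finset ℤ} {Δ : Finset ℕ}
    (h : ∀ b ∈ B, ∀ b' ∈ B, b ≠ b' → ∃ δ ∈ Δ, ExactPow p δ (b - b')) : #B ≤ p ^ #Δ := by
  have : NeZero p := ⟨hp.ne_zero⟩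
  have hcard : #(univ : Finset (Δ → ZMod p)) = p ^ #Δ := by
    simp [ZMod.card]
  rw [← hcard]
  refine card_le_card_of_injOn (fun b δ => ((b / (p : ℤ) ^ (δ : ℕ) : ℤ) : ZMod p))
    (fun _ _ => mem_coe.2 (mem_univ _)) ?_
  intro b hb b' hb' hbb
  by_contra hne
  obtain ⟨δ, hδ, h1, h2⟩ := h b hb b' hb' hne
  have h3 := congrFun hbb ⟨δ, hδ⟩
  simp only [ZMod.intCast_eq_intCast_iff_dvd_sub] at h3
  apply h2
  have hpos : (p : ℤ) ^ δ ≠ 0 := pow_ne_zero _ (by exact_mod_cast hp.ne_zero)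
  obtain ⟨m, hm⟩ := h1
  obtain ⟨k, hk⟩ := h3
  have hb2 : b / (p : ℤ) ^ δ = b' / (p : ℤ) ^ δ + m := by
    rw [show b = b' + p ^ δ * m by linarith, Int.add_mul_ediv_left _ _ hpos]
  rw [hm, pow_succ]
  refine mul_dvd_mul_left _ ⟨-k, by linarith⟩

/-- The integers with `n` digits in base `p` whose nonzero digits are at places in `Δ`. -/
def digitSet (p : ℕ) (Δ : Finset ℕ) : ℕ → Finset ℤ
  | 0 => {0}
  | n + 1 => if n ∈ Δ then (digitSet p Δ n ×ˢ range p).image fun x => x.1 + x.2 * (p : ℤ) ^ n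
      else digitSet p Δ n

lemma exactPow_of_digitSet {p : ℕ} (hp : p.Prime) (Δ : Finset ℕ) (n : ℕ) :
    ∀ x ∈ digitSet p Δ n, ∀ y ∈ digitSet p Δ n, x ≠ y →
      ∃ δ ∈ Δ, δ < n ∧ ExactPow p δ (x - y) := by
  induction n with
  | zero => simp [digitSet]
  | succ n ih =>
    intro x hx y hy hne
    rw [digitSet] at hx hy
    split_ifs at hx hy with hn
    · simp only [mem_image, mem_product, mem_range, Prod.exists] at hx hy
      obtain ⟨x, k, ⟨hx, hk⟩, rfl⟩ := hx
      obtain ⟨y, l, ⟨hy, hl⟩, rfl⟩ := hy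
      by_cases hxy : x = y
      · subst hxy
        refine ⟨n, hn, n.lt_succ_self, ⟨(k : ℤ) - l, by ring⟩, fun h => hne ?_⟩
        rw [show x + k * (p : ℤ) ^ n - (x + l * p ^ n) = p ^ n * (k - l) by ring, pow_succ] at h
        have h2 := Int.dvd_of_mul_dvd_mul_left
          (pow_ne_zero n (by exact_mod_cast hp.ne_zero : (p : ℤ) ≠ 0)) h
        have h3 := Int.eq_zero_of_abs_lt_dvd h2 (by rw [abs_lt]; omega)
        rw [show (k : ℤ) = l by linarith]
      · obtain ⟨δ, hδ, hlt, he⟩ := ih x hx y hy hxy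
        refine ⟨δ, hδ, hlt.trans n.lt_succ_self, ?_⟩
        rw [show x + k * (p : ℤ) ^ n - (y + l * p ^ n) = (x - y) + p ^ n * (k - l) by ring]
        exact he.add_of_dvd hlt (dvd_mul_right _ _)
    · obtain ⟨δ, hδ, hlt, he⟩ := ih x hx y hy hne
      exact ⟨δ, hδ, hlt.trans n.lt_succ_self, he⟩

lemma card_digitSet {p : ℕ} (hp : p.Prime) (Δ : Finset ℕ) (n : ℕ) :
    #(digitSet p Δ n) = p ^ #{δ ∈ range n | δ ∈ Δ} := by
  induction n with
  | zero => simp [digitSet]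
  | succ n ih =>
    rw [digitSet, range_add_one, filter_insert]
    split_ifs with hn
    · rw [card_insert_of_notMem (by simp), pow_succ, ← ih, card_image_of_injOn, card_product,
        card_range]
      rintro ⟨x, k⟩ hx ⟨y, l⟩ hy hxy
      simp only [coe_product, Set.mem_prod, mem_coe, mem_range] at hx hy hxy
      have hp0 : (p : ℤ) ^ n ≠ 0 := pow_ne_zero n (by exact_mod_cast hp.ne_zero : (p : ℤ) ≠ 0)
      by_cases h : x = y
      · subst h
        have h2 : (k : ℤ) * p ^ n = l * p ^ n := by linarith
        have := mul_right_cancel₀ hp0 h2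
        rw [show k = l by exact_mod_cast this]
      · obtain ⟨δ, -, hlt, he⟩ := exactPow_of_digitSet hp Δ n x hx.1 y hy.1 h
        exact absurd ⟨(l : ℤ) - k, by linear_combination hxy⟩ (he.not_dvd hlt)
    · exact ih

/-! ### Spectral pairs and tiling pairs of integers -/

/-- `A` and `L` represent a set in `ℤ/N` and a spectrum of it. -/
def SpectralPair (N : ℕ) (A L : Finset ℤ) : Prop :=
  #A = #L ∧ ∀ l ∈ L, ∀ l' ∈ L, l ≠ l' → ∑ a ∈ A, chr N ((l - l') * a) = 0

/-- `A` and `B` represent sets in `ℤ/N` such that every element of `ℤ/N` is uniquely a sum of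
an element of `A` and an element of `B`. -/
def TilePair (N : ℕ) (A B : Finset ℤ) : Prop :=
  #A * #B = N ∧ ∀ a ∈ A, ∀ a' ∈ A, ∀ b ∈ B, ∀ b' ∈ B,
    (N : ℤ) ∣ (a + b) - (a' + b') → a = a' ∧ b = b'

/-- The character matrix is square, so its scaled conjugate transpose, a right inverse by
orthogonality of the rows, is also a left inverse; this is orthogonality of the columns. -/
lemma SpectralPair.symm {N : ℕ} {A L : Finset ℤ} (h : SpectralPair N A L) :
    SpectralPair N L A := by
  refine ⟨h.1.symm, ?_⟩
  rcases Nat.eq_zero_or_pos #A with h0 | hpos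
  · rw [card_eq_zero.1 h0]
    simp
  set U : Matrix L A ℂ := fun l a => chr N (l * a) with hU
  set V : Matrix A L ℂ := fun a l => (#A : ℂ)⁻¹ * chr N (-(l * a)) with hV
  have hA : (#A : ℂ) ≠ 0 := by exact_mod_cast hpos.ne'
  have hUV : U * V = 1 := by
    ext l l'
    rw [Matrix.mul_apply]
    have h1 : ∀ a : A, U l a * V a l' = (#A : ℂ)⁻¹ * chr N ((l - l') * a) := by
      intro a
      simp only [hU, hV]
      rw [mul_left_comm, ← chr_add]
      ring_nf
    simp_rw [h1]
    rw [← mul_sum, sum_coe_sort A fun a => chr N ((l - l') * a)]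
    by_cases hl : l = l'
    · subst hl
      simp [hA]
    · rw [h.2 l l.2 l' l'.2 (fun h => hl (Subtype.ext h)), mul_zero, Matrix.one_apply_ne hl]
  have hVU : V * U = 1 :=
    (Matrix.mul_eq_one_comm_of_card_eq _ _ _ (by simpa using h.1.symm)).1 hUV
  intro a ha a' ha' hne
  have h2 := congrFun (congrFun hVU ⟨a', ha'⟩) ⟨a, ha⟩
  rw [Matrix.mul_apply, Matrix.one_apply_ne (by simpa using hne.symm)] at h2
  have h3 : ∀ l : L, V ⟨a', ha'⟩ l * U l ⟨a, ha⟩ = (#A : ℂ)⁻¹ * chr N ((a - a') * l) := by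
    intro l
    simp only [hU, hV]
    rw [mul_assoc, ← chr_add]
    ring_nf
  simp_rw [h3] at h2
  rw [← mul_sum, sum_coe_sort L fun l => chr N ((a - a') * l)] at h2
  exact (mul_eq_zero.1 h2).resolve_left (inv_ne_zero hA)

lemma SpectralPair.eq_of_dvd {N : ℕ} (hN : N ≠ 0) {A L : Finset ℤ} (h : SpectralPair N A L)
    {l l' : ℤ} (hl : l ∈ L) (hl' : l' ∈ L) (hd : (N : ℤ) ∣ l - l') : l = l' := by
  by_contra hne
  have h1 := h.2 l hl l' hl' hne
  rw [sum_congr rfl fun a _ => (chr_eq_one_iff hN ((l - l') * a)).2 (hd.mul_right a)] at h1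
  simp only [sum_const, nsmul_eq_mul, mul_one, Nat.cast_eq_zero] at h1
  rw [h.1, card_eq_zero] at h1
  simp [h1] at hl

lemma SpectralPair.eq_of_dvd_left {N : ℕ} (hN : N ≠ 0) {A L : Finset ℤ} (h : SpectralPair N A L)
    {a a' : ℤ} (ha : a ∈ A) (ha' : a' ∈ A) (hd : (N : ℤ) ∣ a - a') : a = a' :=
  h.symm.eq_of_dvd hN ha ha' hd

lemma SpectralPair.vanishes {M K : ℕ} (hM : M ≠ 0) (hK : K ≠ 0) {A L : Finset ℤ}
    (h : SpectralPair (M * K) A L) {l l' : ℤ} (hl : l ∈ L) (hl' : l' ∈ L) (hne : l ≠ l') {u : ℤ}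
    (hu : l - l' = K * u) (hc : IsCoprime u M) : Vanishes A M :=
  vanishes_of_factor hM hK hu hc (h.2 l hl l' hl' hne)

lemma TilePair.symm {N : ℕ} {A B : Finset ℤ} (h : TilePair N A B) : TilePair N B A := by
  refine ⟨by rw [mul_comm]; exact h.1, fun b hb b' hb' a ha a' ha' hd => ?_⟩
  exact (h.2 a ha a' ha' b hb b' hb' (by rwa [add_comm a, add_comm a'])).symm

lemma card_mul_card_le {N : ℕ} (hN : N ≠ 0) {A B : Finset ℤ}
    (h : ∀ a ∈ A, ∀ a' ∈ A, ∀ b ∈ B, ∀ b' ∈ B,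
      (N : ℤ) ∣ (a + b) - (a' + b') → a = a' ∧ b = b') : #A * #B ≤ N := by
  have : NeZero N := ⟨hN⟩
  rw [← card_product]
  have : #(univ : Finset (ZMod N)) = N := by simp [ZMod.card]
  rw [← this]
  refine card_le_card_of_injOn (fun x => ((x.1 + x.2 : ℤ) : ZMod N))
    (fun _ _ => mem_coe.2 (mem_univ _)) ?_
  rintro ⟨a, b⟩ hx ⟨a', b'⟩ hy hxy
  simp only [coe_product, Set.mem_prod, mem_coe] at hx hy
  have h2 := (ZMod.intCast_eq_intCast_iff_dvd_sub _ _ _).1 hxy.symm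
  obtain ⟨rfl, rfl⟩ := h a hx.1 a' hy.1 b hx.2 b' hy.2 h2
  rfl

lemma isCoprime_prime_of_not_dvd {p : ℕ} (hp : p.Prime) {u : ℤ} (hu : ¬ (p : ℤ) ∣ u) :
    IsCoprime u p :=
  ((Nat.prime_iff_prime_int.1 hp).coprime_iff_not_dvd.2 hu).symm

lemma isCoprime_pow_of_not_dvd {p : ℕ} (hp : p.Prime) {u : ℤ} (hu : ¬ (p : ℤ) ∣ u) (n : ℕ) :
    IsCoprime u ((p ^ n : ℕ) : ℤ) := by
  push_cast
  exact (isCoprime_prime_of_not_dvd hp hu).pow_right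

lemma isCoprime_primes {p q : ℕ} (hp : p.Prime) (hq : q.Prime) (hpq : p ≠ q) :
    IsCoprime (p : ℤ) (q : ℤ) :=
  Nat.isCoprime_iff_coprime.2 ((Nat.coprime_primes hp hq).2 hpq)

lemma not_prime_dvd_prime_pow {p q : ℕ} (hp : p.Prime) (hq : q.Prime) (hpq : p ≠ q) (n : ℕ) :
    ¬ (p : ℤ) ∣ (q : ℤ) ^ n := by
  intro h
  have h2 := (Nat.prime_iff_prime_int.1 hp).dvd_of_dvd_pow h
  exact hpq ((Nat.prime_dvd_prime_iff_eq hp hq).1 (by exact_mod_cast h2))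

lemma pow_card_dvd_card_of_subset {p : ℕ} (hp : p.Prime) {A : Finset ℤ} {n : ℕ} {Δ : Finset ℕ}
    (hΔ : Δ ⊆ range n) (h : ∀ δ ∈ Δ, Vanishes A (p ^ (n - δ))) : p ^ #Δ ∣ #A := by
  classical
  refine dvd_trans (pow_dvd_pow p ?_) (pow_card_dvd_card hp A n)
  -- The order `p ^ (n - δ)` is `p ^ (j + 1)` for `j = n - 1 - δ`.
  refine card_le_card_of_injOn (fun δ => n - 1 - δ) ?_ ?_
  · intro δ hδ
    have h1 := mem_range.1 (hΔ hδ)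
    simp only [coe_filter, mem_range, Set.mem_ofPred_eq]
    refine ⟨by omega, ?_⟩
    rw [show n - 1 - δ + 1 = n - δ by omega]
    exact h δ hδ
  · intro x hx y hy hxy
    have h1 := mem_range.1 (hΔ hx)
    have h2 := mem_range.1 (hΔ hy)
    simp only at hxy
    omega

lemma card_filter_mem_sdiff {n : ℕ} {Δ : Finset ℕ} (hΔ : Δ ⊆ range n) :
    #{δ ∈ range n | δ ∈ range n \ Δ} + #Δ = n := by
  have h1 : ({δ ∈ range n | δ ∈ range n \ Δ} : Finset ℕ) = range n \ Δ := by
    ext δ; simp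
  rw [h1, card_sdiff_of_subset hΔ, card_range]
  have := card_le_card hΔ
  rw [card_range] at this
  omega

/-! ### Spectral sets: a direct complement and two descents -/

lemma dvd_and_dvd_of_coprime_mul_dvd {a b : ℤ} {x : ℤ} (h : a * b ∣ x) : a ∣ x ∧ b ∣ x :=
  ⟨(dvd_mul_right a b).trans h, (dvd_mul_left b a).trans h⟩

lemma SpectralPair.vanishes_of_exactPow {p : ℕ} (hp : p.Prime) {n Q : ℕ} (hQ : Q ≠ 0)
    (hpQ : IsCoprime (p : ℤ) Q) {A L : Finset ℤ} (h : SpectralPair (p ^ n * Q) A L)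
    {l l' : ℤ} (hl : l ∈ L) (hl' : l' ∈ L) (hd : (Q : ℤ) ∣ l - l') {δ : ℕ} (hδ : δ < n)
    (he : ExactPow p δ (l - l')) : Vanishes A (p ^ (n - δ)) := by
  have hne : l ≠ l' := by
    rintro rfl
    exact he.2 (by simp)
  obtain ⟨u, hu, hpu⟩ := he.eq_mul
  rw [hu] at hd
  obtain ⟨v, rfl⟩ := (hpQ.symm.pow_right).dvd_of_dvd_mul_left hd
  have hN : p ^ n * Q = p ^ (n - δ) * (p ^ δ * Q) := by
    rw [← mul_assoc, ← pow_add, Nat.sub_add_cancel hδ.le]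
  rw [hN] at h
  refine h.vanishes (pow_ne_zero _ hp.ne_zero) (mul_ne_zero (pow_ne_zero _ hp.ne_zero) hQ)
    hl hl' hne (u := v) ?_ ?_
  · rw [hu]; push_cast; ring
  · exact isCoprime_pow_of_not_dvd hp (fun h => hpu (h.mul_left _)) _

/-- Let `Δ` collect the `p`-adic valuations of the nonzero differences of `A` divisible by `Q`. A
class modulo `Q` holds at most `p ^ #Δ` points of `A`, while duality makes `L` vanish at `#Δ` powers
of `p`, so `p ^ #Δ` divides `#A`. With the divisibility by `Q` this gives `#A = Q * p ^ #Δ`, and `Q`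
times the expansions with digits outside `Δ` is a complement. -/
lemma exists_tilePair_of_dvd_card {p : ℕ} (hp : p.Prime) {n Q : ℕ} (hQ : Q ≠ 0)
    (hpQ : IsCoprime (p : ℤ) Q) {A L : Finset ℤ} (hA : A.Nonempty)
    (h : SpectralPair (p ^ n * Q) A L) (hdvd : Q ∣ #A) : ∃ B, TilePair (p ^ n * Q) A B := by
  classical
  have hN : p ^ n * Q ≠ 0 := mul_ne_zero (pow_ne_zero _ hp.ne_zero) hQ
  set Δ : Finset ℕ := {δ ∈ range n | ∃ a ∈ A, ∃ a' ∈ A, (Q : ℤ) ∣ a - a' ∧ ExactPow p δ (a - a')}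
    with hΔ
  have hsub : Δ ⊆ range n := filter_subset _ _
  have hex : ∀ a ∈ A, ∀ a' ∈ A, a ≠ a' → (Q : ℤ) ∣ a - a' →
      ∃ δ ∈ Δ, ExactPow p δ (a - a') := by
    intro a ha a' ha' hne hd
    have h1 : ¬ (p : ℤ) ^ n ∣ a - a' := by
      intro h1
      refine hne (h.eq_of_dvd_left hN ha ha' ?_)
      push_cast
      exact (hpQ.pow_left).mul_dvd h1 hd
    obtain ⟨δ, hδ, he⟩ := exists_exactPow h1
    exact ⟨δ, by simp only [hΔ, mem_filter, mem_range]; exact ⟨hδ, a, ha, a', ha', hd, he⟩, he⟩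
  have hle : #A ≤ Q * p ^ #Δ := by
    rw [card_eq_sum_cnt (A := A) hQ]
    refine (sum_le_card_nsmul _ _ (p ^ #Δ) fun k _ => ?_).trans (by simp)
    refine card_le_pow_of_exactPow hp fun b hb b' hb' hne => ?_
    rw [mem_filter] at hb hb'
    refine hex b hb.1 b' hb'.1 hne ?_
    have := dvd_sub hb.2 hb'.2
    rwa [sub_sub_sub_cancel_right] at this
  have hdvd2 : p ^ #Δ ∣ #A := by
    rw [h.1]
    refine pow_card_dvd_card_of_subset hp hsub fun δ hδ => ?_
    simp only [hΔ, mem_filter, mem_range] at hδ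
    obtain ⟨hδn, a, ha, a', ha', hd, he⟩ := hδ
    exact h.symm.vanishes_of_exactPow hp hQ hpQ ha ha' hd hδn he
  have hcard : #A = Q * p ^ #Δ := by
    refine le_antisymm hle (Nat.le_of_dvd hA.card_pos ?_)
    refine Nat.Coprime.mul_dvd_of_dvd_of_dvd ?_ hdvd hdvd2
    rw [← Nat.isCoprime_iff_coprime]
    push_cast
    exact hpQ.symm.pow_right
  have hQ' : (Q : ℤ) ≠ 0 := by exact_mod_cast hQ
  refine ⟨(digitSet p (range n \ Δ) n).image fun x => (Q : ℤ) * x, ?_, ?_⟩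
  · rw [card_image_of_injective _ (mul_right_injective₀ hQ'), card_digitSet hp, hcard,
      mul_assoc, ← pow_add, add_comm (#Δ), card_filter_mem_sdiff hsub, mul_comm]
  · intro a ha a' ha' b hb b' hb' hd
    obtain ⟨x, hx, rfl⟩ := mem_image.1 hb
    obtain ⟨y, hy, rfl⟩ := mem_image.1 hb'
    push_cast at hd
    obtain ⟨h1, h2⟩ := dvd_and_dvd_of_coprime_mul_dvd hd
    have hQa : (Q : ℤ) ∣ a - a' := by
      have : a - a' = (a + Q * x - (a' + Q * y)) - Q * (x - y) := by ring
      rw [this]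
      exact dvd_sub h2 (dvd_mul_right _ _)
    have haa : a = a' := by
      by_contra hne
      obtain ⟨δ, hδ, he⟩ := hex a ha a' ha' hne hQa
      have hδn := mem_range.1 (hsub hδ)
      have h3 : ExactPow p δ (Q * (y - x)) := by
        have := he.add_of_dvd hδn ((dvd_neg).2 h1)
        rwa [show a - a' + -(a + Q * x - (a' + Q * y)) = Q * (y - x) by ring] at this
      have hyx : y ≠ x := by
        rintro rfl
        exact h3.2 (by simp)
      obtain ⟨ε, hε, -, he'⟩ := exactPow_of_digitSet hp _ n y hy x hx hyx
      have hpQ' : ¬ (p : ℤ) ∣ Q := by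
        intro hpd
        exact (Nat.prime_iff_prime_int.1 hp).not_isUnit (hpQ.isUnit_of_dvd' dvd_rfl hpd)
      have := h3.unique (he'.mul_left hp hpQ')
      subst this
      exact (mem_sdiff.1 hε).2 hδ
    subst haa
    refine ⟨rfl, ?_⟩
    by_contra hne
    have hxy : x ≠ y := fun h => hne (by rw [h])
    obtain ⟨ε, -, hεn, he'⟩ := exactPow_of_digitSet hp _ n x hx y hy hxy
    have h4 : (p : ℤ) ^ n ∣ Q * (x - y) := by
      rwa [show a + Q * x - (a + Q * y) = Q * (x - y) by ring] at h1
    exact he'.not_dvd hεn (hpQ.pow_left.dvd_of_dvd_mul_left h4)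

/-- After translation and division by `r` the spectrum serves for `A` modulo `M`; the full preimage
in ℤ/(M r) of a complement modulo `M` is then a complement. -/
lemma exists_tilePair_of_spectrum_coset {M r : ℕ} (hM : M ≠ 0) (hr : r ≠ 0) {A L : Finset ℤ}
    (hA : A.Nonempty) (h : SpectralPair (M * r) A L) {c : ℤ} (hc : ∀ l ∈ L, (r : ℤ) ∣ l - c)
    (ih : ∀ L', SpectralPair M A L' → ∃ B, TilePair M A B) : ∃ B, TilePair (M * r) A B := by
  have hM' : (M : ℤ) ≠ 0 := by exact_mod_cast hM
  have key : ∀ l ∈ L, r * ((l - c) / r) = l - c := fun l hl => Int.mul_ediv_cancel' (hc l hl)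
  obtain ⟨B, hB⟩ : ∃ B, TilePair M A B := by
    apply ih (L.image fun l => (l - c) / (r : ℤ))
    refine ⟨?_, ?_⟩
    · rw [card_image_of_injOn, h.1]
      intro x hx y hy hxy
      have h1 := key x hx
      have h2 := key y hy
      simp only at hxy
      rw [hxy, h2] at h1
      linarith
    · intro l hl l' hl' hne
      obtain ⟨x, hx, rfl⟩ := mem_image.1 hl
      obtain ⟨y, hy, rfl⟩ := mem_image.1 hl'
      rw [← h.2 x hx y hy (fun h => hne (by rw [h]))]
      refine sum_congr rfl fun a _ => ?_
      rw [← chr_mul_right hr]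
      congr 1
      linear_combination a * key x hx - a * key y hy
  have hdir : ∀ a ∈ A, ∀ a' ∈ A, ∀ b ∈ B, ∀ b' ∈ B, ∀ k < r, ∀ k' < r,
      ((M * r : ℕ) : ℤ) ∣ (a + (b + M * k)) - (a' + (b' + M * k')) →
      a = a' ∧ b = b' ∧ k = k' := by
    intro a ha a' ha' b hb b' hb' k hk k' hk' hd
    push_cast at hd
    obtain ⟨rfl, rfl⟩ := hB.2 a ha a' ha' b hb b' hb' (by
      have h1 := (dvd_mul_right (M : ℤ) r).trans hd
      have : a + b - (a' + b') = (a + (b + M * k)) - (a' + (b' + M * k')) - M * (k - k') := by ring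
      rw [this]
      exact dvd_sub h1 (dvd_mul_right _ _))
    refine ⟨rfl, rfl, ?_⟩
    rw [show a + (b + M * (k : ℤ)) - (a + (b + M * k')) = M * (k - k') by ring] at hd
    have h2 := Int.dvd_of_mul_dvd_mul_left hM' hd
    have h3 := Int.eq_zero_of_abs_lt_dvd h2 (by rw [abs_lt]; omega)
    omega
  refine ⟨(B ×ˢ range r).image fun x => x.1 + M * (x.2 : ℤ), ?_, ?_⟩
  · rw [card_image_of_injOn, card_product, card_range, ← mul_assoc, hB.1]
    rintro ⟨b, k⟩ hx ⟨b', k'⟩ hy hxy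
    simp only [coe_product, Set.mem_prod, mem_coe, mem_range] at hx hy hxy
    obtain ⟨a, ha⟩ := hA
    obtain ⟨-, rfl, rfl⟩ := hdir a ha a ha b hx.1 b' hy.1 k hx.2 k' hy.2 (by rw [hxy]; simp)
    rfl
  · intro a ha a' ha' b hb b' hb' hd
    simp only [mem_image, mem_product, mem_range, Prod.exists] at hb hb'
    obtain ⟨b, k, ⟨hb, hk⟩, rfl⟩ := hb
    obtain ⟨b', k', ⟨hb', hk'⟩, rfl⟩ := hb'
    obtain ⟨rfl, rfl, rfl⟩ := hdir a ha a' ha' b hb b' hb' k hk k' hk' hd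
    exact ⟨rfl, rfl⟩

/-- Here `A` is the full preimage of its reduction modulo `M`. By pigeonhole some class of `L`
modulo `r` has at least `#L / r` elements, enough for a spectrum of the reduction, and a complement
of the reduction also complements `A`. -/
lemma exists_tilePair_of_periodic {M r : ℕ} (hM : M ≠ 0) (hr : r ≠ 0) {A L : Finset ℤ}
    (hA : A.Nonempty) (h : SpectralPair (M * r) A L)
    (hper : ∀ a ∈ A, ∀ k : ℤ, ∃ a' ∈ A, ((M * r : ℕ) : ℤ) ∣ a' - (a + k * M))
    (ih : ∀ A' L' : Finset ℤ, A'.Nonempty → SpectralPair M A' L' → ∃ B, TilePair M A' B) :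
    ∃ B, TilePair (M * r) A B := by
  have hN : M * r ≠ 0 := mul_ne_zero hM hr
  have hr' : (r : ℤ) ≠ 0 := by exact_mod_cast hr
  set A' := A.image fun a => a % (M : ℤ) with hA'
  have hmod : ∀ a : ℤ, (M : ℤ) ∣ a % M - a := fun a =>
    ⟨-(a / M), by linarith [Int.emod_add_mul_ediv a M]⟩
  have hfib : ∀ a' ∈ A', #{a ∈ A | a % (M : ℤ) = a'} = r := by
    intro a' ha'
    obtain ⟨a0, ha0, rfl⟩ := mem_image.1 ha'
    have h1 : #{a ∈ A | a % (M : ℤ) = a0 % M} = cnt A M a0 := by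
      unfold cnt
      congr 1
      exact filter_congr fun a _ =>
        Int.emod_eq_emod_iff_emod_sub_eq_zero.trans Int.dvd_iff_emod_eq_zero.symm
    rw [h1, cnt_eq_sum hM hr]
    have h2 : ∀ k ∈ range r, cnt A (M * r) (a0 + k * M) = 1 := by
      intro k _
      refine le_antisymm ?_ (cnt_pos.2 (hper a0 ha0 k))
      refine card_le_one.2 fun x hx y hy => ?_
      rw [mem_filter] at hx hy
      refine h.eq_of_dvd_left hN hx.1 hy.1 ?_
      have := dvd_sub hx.2 hy.2
      rwa [sub_sub_sub_cancel_right] at this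
    rw [sum_congr rfl h2]
    simp
  have hcard : #A = #A' * r := by
    rw [card_eq_sum_card_image (fun a => a % (M : ℤ)) A, sum_congr rfl hfib]
    simp [hA']
  obtain ⟨y, -, hy⟩ : ∃ y ∈ (range r).image (Nat.cast : ℕ → ℤ),
      #A' ≤ #{l ∈ L | l % (r : ℤ) = y} := by
    apply exists_le_card_fiber_of_mul_le_card_of_maps_to
    · intro l _
      have h1 := Int.emod_nonneg l hr'
      have h2 := Int.emod_lt_of_pos l (b := r) (by positivity)
      exact mem_image.2 ⟨(l % r).toNat, mem_range.2 (by omega), by omega⟩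
    · exact (nonempty_range_iff.2 hr).image _
    · rw [card_image_of_injective _ Nat.cast_injective, card_range, ← h.1, hcard, mul_comm]
  obtain ⟨L0, hL0, hL0c⟩ := exists_subset_card_eq hy
  have key : ∀ l ∈ L0, r * (l / r) = l - y := by
    intro l hl
    have := (mem_filter.1 (hL0 hl)).2
    linarith [Int.emod_add_mul_ediv l r]
  obtain ⟨B, hB⟩ : ∃ B, TilePair M A' B := by
    apply ih A' (L0.image fun l => l / (r : ℤ)) (hA.image _)
    refine ⟨?_, ?_⟩
    · refine hL0c.symm.trans (card_image_of_injOn ?_).symm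
      intro x hx z hz hxz
      have h1 := key x hx
      have h2 := key z hz
      simp only at hxz
      rw [hxz, h2] at h1
      linarith
    · intro l hl l' hl' hne
      obtain ⟨x, hx, rfl⟩ := mem_image.1 hl
      obtain ⟨z, hz, rfl⟩ := mem_image.1 hl'
      have h1 := h.2 x (mem_filter.1 (hL0 hx)).1 z (mem_filter.1 (hL0 hz)).1
        (fun h => hne (by rw [h]))
      have h2 : ∀ a : ℤ, chr (M * r) ((x - z) * a) = chr M ((x / r - z / r) * (a % M)) := by
        intro a
        rw [show (x - z) * a = r * ((x / r - z / r) * a) by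
          linear_combination a * key z hz - a * key x hx, chr_mul_right hr]
        apply chr_congr hM
        rw [← mul_sub]
        refine Dvd.dvd.mul_left ?_ _
        rw [← neg_sub]
        exact (dvd_neg).2 (hmod a)
      simp_rw [h2] at h1
      rw [sum_comp (fun a => chr M ((x / r - z / r) * a)) (fun a => a % (M : ℤ)),
        sum_congr rfl fun b hb => by rw [hfib b hb], ← smul_sum, nsmul_eq_mul] at h1
      exact (mul_eq_zero.1 h1).resolve_left (by exact_mod_cast hr)
  refine ⟨B, by rw [hcard, mul_right_comm, hB.1], fun a ha a' ha' b hb b' hb' hd => ?_⟩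
  have h1 : (M : ℤ) ∣ a + b - (a' + b') := by
    push_cast at hd
    exact (dvd_mul_right _ _).trans hd
  obtain ⟨h2, rfl⟩ := hB.2 (a % M) (mem_image_of_mem _ ha) (a' % M) (mem_image_of_mem _ ha')
    b hb b' hb' (by
      rw [show a % M + b - (a' % M + b') =
        (a + b - (a' + b')) + (a % M - a) - (a' % M - a') by ring]
      exact dvd_sub (dvd_add h1 (hmod a)) (hmod a'))
  refine ⟨h.eq_of_dvd_left hN ha ha' ?_, rfl⟩
  rwa [add_sub_add_right_eq_sub] at hd

/-! ### Vanishing at composite orders -/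

lemma exists_not_dvd_not_dvd {L : Finset ℤ} {p q : ℤ} (hp : ¬ ∃ c, ∀ l ∈ L, p ∣ l - c)
    (hq : ¬ ∃ c, ∀ l ∈ L, q ∣ l - c) : ∃ l ∈ L, ∃ l' ∈ L, ¬ p ∣ l - l' ∧ ¬ q ∣ l - l' := by
  by_contra! hcon
  push Not at hp hq
  obtain ⟨x, hx, -⟩ := hp 0
  obtain ⟨y, hy, hxy⟩ := hp x
  have h1 := hcon y hy x hx hxy
  obtain ⟨z, hz, hzx⟩ := hq x
  by_cases h2 : p ∣ z - x
  · have h3 : ¬ p ∣ z - y := by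
      intro h3
      apply hxy
      rw [show y - x = (z - x) - (z - y) by ring]
      exact dvd_sub h2 h3
    have h4 := hcon z hz y hy h3
    apply hzx
    rw [show z - x = (z - y) + (y - x) by ring]
    exact dvd_add h4 h1
  · exact hzx (hcon z hz x hx h2)

/-- If the indicator of `A` is not invariant under translation by the subgroup of order `p`, then
`A` contains a coset of the subgroup of order `q` and misses a translate of it. -/
lemma exists_fiber_of_not_periodic {p q P Q N : ℕ} (hN : N ≠ 0) (hP : N = p * P)
    (hQ : N = q * Q) (hc : ∀ l : ℕ, ¬ p ∣ l → ¬ q ∣ l → l.Coprime N) {A : Finset ℤ}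
    (hinj : ∀ a ∈ A, ∀ a' ∈ A, (N : ℤ) ∣ a - a' → a = a') (hv : Vanishes A N)
    (hper : ¬ ∀ a ∈ A, ∀ k : ℤ, ∃ a' ∈ A, (N : ℤ) ∣ a' - (a + k * P)) :
    ∃ a ∈ A, ∃ k : ℤ, (∀ l : ℤ, ∃ a' ∈ A, (N : ℤ) ∣ a' - (a + l * Q)) ∧
      ∀ l : ℤ, ∀ a' ∈ A, ¬ (N : ℤ) ∣ a' - (a + k * P + l * Q) := by
  push Not at hper
  obtain ⟨a, ha, k, hk⟩ := hper
  have hle : ∀ r, cnt A N r ≤ 1 := by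
    intro r
    refine card_le_one.2 fun x hx y hy => ?_
    rw [mem_filter] at hx hy
    refine hinj x hx.1 y hy.1 ?_
    have := dvd_sub hx.2 hy.2
    rwa [sub_sub_sub_cancel_right] at this
  have h0 : cnt A N (a + k * P) = 0 := by
    by_contra h0
    obtain ⟨a', ha', hd⟩ := cnt_pos.1 (Nat.pos_of_ne_zero h0)
    exact hk a' ha' hd
  have h1 := cnt_self_pos ha N
  refine ⟨a, ha, k, fun l => ?_, fun l a' ha' hd => ?_⟩
  -- The counts are 0 or 1. A 1 at `a` and a 0 at its `P`-translate force, in the grid relation, a 1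
  -- at every `Q`-translate of `a` and a 0 at every `Q`-translate of the missing point.
  · have h2 := cnt_grid_of_vanishes hN hP hQ hc hv a k l
    exact cnt_pos.1 (by omega)
  · have h2 := cnt_grid_of_vanishes hN hP hQ hc hv a k l
    have h3 := hle (a + l * Q)
    have h4 : 0 < cnt A N (a + k * P + l * Q) := cnt_pos.2 ⟨a', ha', hd⟩
    omega

lemma sum_fiberwise_mod {M : ℕ} (hM : M ≠ 0) (f : ℤ → ℂ) (L : Finset ℤ) :
    ∑ l ∈ L, f l = ∑ r ∈ range M, ∑ l ∈ L with (M : ℤ) ∣ l - r, f l := by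
  have hM' : (M : ℤ) ≠ 0 := by exact_mod_cast hM
  have h1 : ∀ l ∈ L, (l % (M : ℤ)).toNat ∈ range M := by
    intro l _
    have h1 := Int.emod_nonneg l hM'
    have h2 := Int.emod_lt_of_pos l (b := M) (by positivity)
    rw [mem_range]
    omega
  rw [← sum_fiberwise_of_maps_to h1]
  refine sum_congr rfl fun r hr => ?_
  congr 1
  refine filter_congr fun l _ => ?_
  rw [← Int.emod_emod_of_dvd l (dvd_refl (M : ℤ))]
  have h3 := Int.emod_nonneg l hM'
  have h4 : (r : ℤ) % M = r := Int.emod_eq_of_lt (by positivity) (by exact_mod_cast mem_range.1 hr)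
  rw [Int.dvd_iff_emod_eq_zero, ← Int.emod_eq_emod_iff_emod_sub_eq_zero, h4,
    Int.emod_emod_of_dvd l (dvd_refl (M : ℤ))]
  omega

lemma sum_eq_sum_cnt {M : ℕ} (hM : M ≠ 0) {f : ℤ → ℂ} (hf : ∀ x y : ℤ, (M : ℤ) ∣ x - y → f x = f y)
    (L : Finset ℤ) : ∑ l ∈ L, f l = ∑ r ∈ range M, cnt L M r * f r := by
  rw [sum_fiberwise_mod hM]
  refine sum_congr rfl fun r _ => ?_
  rw [sum_congr rfl fun l hl => hf l r (mem_filter.1 hl).2]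
  simp [cnt]

lemma sum_range_shift {M : ℕ} {g : ℤ → ℂ} (hg : ∀ x, g (x + M) = g x) (h : ℕ) :
    ∑ r ∈ range M, g (r + h) = ∑ r ∈ range M, g r := by
  induction h with
  | zero => simp
  | succ h ih =>
    rw [← ih]
    have h1 := sum_range_succ (fun r : ℕ => g (r + h)) M
    have h2 := sum_range_succ' (fun r : ℕ => g (r + h)) M
    rw [h1] at h2
    have h3 : g ((M : ℕ) + h) = g ((0 : ℕ) + h) := by
      rw [add_comm, hg]
      simp
    rw [h3] at h2
    have := add_right_cancel h2
    rw [this]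
    refine sum_congr rfl fun r _ => ?_
    push_cast
    ring_nf

/-- Translation by `P` multiplies the sum by `chr d P ≠ 1` and also preserves it. -/
lemma vanishes_of_cnt_shift {M d P : ℕ} (hM : M ≠ 0) (hd : d ∣ M) (hP : ¬ d ∣ P) {L : Finset ℤ}
    (h : ∀ r, cnt L M (r + P) = cnt L M r) : Vanishes L d := by
  have hd0 : d ≠ 0 := fun h0 => hM (by rw [h0] at hd; exact zero_dvd_iff.1 hd)
  have hdM : (d : ℤ) ∣ M := by exact_mod_cast hd
  have h1 := sum_eq_sum_cnt hM (f := chr d) (fun x y hxy => chr_congr hd0 (hdM.trans hxy)) L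
  have h2 := sum_range_shift (M := M) (g := fun x => cnt L M x * chr d x) (fun x => by
    rw [cnt_congr L (r := x + M) (s := x) (by simp),
      chr_congr hd0 (x := x + M) (y := x) (by simpa using hdM)]) P
  have h3 : ∀ r ∈ range M, (cnt L M (r + P) * chr d (r + P) : ℂ) =
      chr d P * (cnt L M r * chr d r) := by
    intro r _
    rw [h, chr_add]
    ring
  rw [sum_congr rfl h3, ← mul_sum, ← h1] at h2
  have h4 : chr d P ≠ 1 := by
    rw [Ne, chr_eq_one_iff hd0]
    exact_mod_cast hP
  have h5 : (chr d P - 1) * ∑ l ∈ L, chr d l = 0 := by rw [sub_mul, h2]; ring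
  exact (mul_eq_zero.1 h5).resolve_left (sub_ne_zero.2 h4)

/-- If a count dropped under a shift by `p ^ j * q ^ 2`, the grid relation would give two elements
of `L` differing by `p ^ (j + 1) * q` modulo `M`, a difference divisible by `q` but not by `q ^ 2`.
So the counts are invariant under that shift, which is not a multiple of `p ^ (j + 1)`. -/
lemma vanishes_prime_pow_of_vanishes_mul_sq {p q : ℕ} (hp : p.Prime) (hq : q.Prime) (hpq : p ≠ q)
    {j : ℕ} {L : Finset ℤ} (hL : ∀ l ∈ L, ∀ l' ∈ L, (q : ℤ) ∣ l - l' → (q : ℤ) ^ 2 ∣ l - l')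
    (h : Vanishes L (p ^ (j + 1) * q ^ 2)) : Vanishes L (p ^ (j + 1)) := by
  set M := p ^ (j + 1) * q ^ 2 with hM
  have hM0 : M ≠ 0 := mul_ne_zero (pow_ne_zero _ hp.ne_zero) (pow_ne_zero _ hq.ne_zero)
  have hP : M = p * (p ^ j * q ^ 2) := by rw [hM]; ring
  have hQ : M = q * (p ^ (j + 1) * q) := by rw [hM]; ring
  have hc : ∀ l : ℕ, ¬ p ∣ l → ¬ q ∣ l → l.Coprime M := by
    intro l h1 h2
    exact Nat.Coprime.mul_right
      (Nat.Coprime.pow_right _ ((Nat.Prime.coprime_iff_not_dvd hp).2 h1).symm)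
      (Nat.Coprime.pow_right _ ((Nat.Prime.coprime_iff_not_dvd hq).2 h2).symm)
  have hle : ∀ r k : ℤ, cnt L M r ≤ cnt L M (r + k * (p ^ j * q ^ 2 : ℕ)) := by
    intro r k
    by_contra! hlt
    have h1 := cnt_grid_of_vanishes hM0 hP hQ hc h r k 1
    obtain ⟨l, hl, hlr⟩ := cnt_pos.1 (show 0 < cnt L M r by omega)
    obtain ⟨l', hl', hlr'⟩ := cnt_pos.1
      (show 0 < cnt L M (r + 1 * (p ^ (j + 1) * q : ℕ)) by omega)
    have h2 : (M : ℤ) ∣ l' - l - p ^ (j + 1) * q := by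
      have := dvd_sub hlr' hlr
      push_cast at this
      rwa [show l' - (r + 1 * ((p : ℤ) ^ (j + 1) * q)) - (l - r) = l' - l - p ^ (j + 1) * q by ring]
        at this
    have h3 : (q : ℤ) ^ 2 ∣ l' - l - p ^ (j + 1) * q := by
      refine dvd_trans ?_ h2
      rw [hM]
      push_cast
      exact dvd_mul_left _ _
    have h4 : (q : ℤ) ∣ l' - l := by
      have h5 : (q : ℤ) ∣ l' - l - p ^ (j + 1) * q := (dvd_pow_self _ two_ne_zero).trans h3
      exact (dvd_sub_left (dvd_mul_left _ _)).1 h5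
    have h6 := (dvd_sub_right (hL l' hl' l hl h4)).1 h3
    rw [pow_two] at h6
    exact not_prime_dvd_prime_pow hq hp hpq.symm _
      (Int.dvd_of_mul_dvd_mul_right (by exact_mod_cast hq.ne_zero) h6)
  refine vanishes_of_cnt_shift (M := M) (P := p ^ j * q ^ 2) hM0
    (by rw [hM]; exact dvd_mul_right _ _)
    ?_ fun r => le_antisymm ?_ ?_
  · rw [pow_succ]
    intro hd
    have := Nat.dvd_of_mul_dvd_mul_left (pow_pos hp.pos _) hd
    exact not_prime_dvd_prime_pow hp hq hpq 2 (by exact_mod_cast this)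
  · have := hle (r + (p ^ j * q ^ 2 : ℕ)) (-1)
    rwa [show r + ((p ^ j * q ^ 2 : ℕ) : ℤ) + -1 * (p ^ j * q ^ 2 : ℕ) = r by ring] at this
  · have := hle r 1
    rwa [one_mul] at this

/-! ### The irreducible case with factor `q ^ 2` -/

/-- If differences of `L` divisible by `q` are divisible by `q ^ 2`, and differences of `A`
divisible by `p ^ n` are divisible by `q`, then `A` tiles. -/
lemma exists_tilePair_of_differences {p q : ℕ} (hp : p.Prime) (hq : q.Prime) (hpq : p ≠ q)
    {n a : ℕ} {A L : Finset ℤ} (h : SpectralPair (p ^ n * q ^ 2) A L) (hcard : #A = q * p ^ a)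
    (hL : ∀ l ∈ L, ∀ l' ∈ L, (q : ℤ) ∣ l - l' → (q : ℤ) ^ 2 ∣ l - l')
    (hA : ∀ x ∈ A, ∀ y ∈ A, (p : ℤ) ^ n ∣ x - y → (q : ℤ) ∣ x - y) :
    ∃ B, TilePair (p ^ n * q ^ 2) A B := by
  classical
  have hp0 := hp.ne_zero
  have hq0 := hq.ne_zero
  have hcop := isCoprime_primes hp hq hpq
  have hN : p ^ n * q ^ 2 ≠ 0 := mul_ne_zero (pow_ne_zero _ hp0) (pow_ne_zero _ hq0)
  set Δ : Finset ℕ := {δ ∈ range n | Vanishes L (p ^ (n - δ))} with hΔ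
  have hsub : Δ ⊆ range n := filter_subset _ _
  set D := digitSet p (range n \ Δ) n with hD
  -- A difference prime to `q` has order `p ^ (n - δ) * q ^ 2`, which the previous lemma lowers to
  -- `p ^ (n - δ)`; one divisible by `q ^ 2` has that order already.
  have hex : ∀ x ∈ A, ∀ y ∈ A, x ≠ y → ∀ δ < n, ExactPow p δ (x - y) →
      ((q : ℤ) ∣ x - y → (q : ℤ) ^ 2 ∣ x - y) → δ ∈ Δ := by
    intro x hx y hy hne δ hδ he himp
    rw [hΔ, mem_filter, mem_range]
    refine ⟨hδ, ?_⟩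
    by_cases hqd : (q : ℤ) ∣ x - y
    · exact h.symm.vanishes_of_exactPow hp (pow_ne_zero 2 hq0)
        (by push_cast; exact hcop.pow_right) hx hy (by push_cast; exact himp hqd) hδ he
    · obtain ⟨j, hj⟩ : ∃ j, n - δ = j + 1 := ⟨n - δ - 1, by omega⟩
      rw [hj]
      refine vanishes_prime_pow_of_vanishes_mul_sq hp hq hpq hL ?_
      rw [← hj]
      obtain ⟨u, hu, hpu⟩ := he.eq_mul
      have hN2 : p ^ n * q ^ 2 = p ^ (n - δ) * q ^ 2 * p ^ δ := by
        rw [mul_right_comm, ← pow_add, Nat.sub_add_cancel hδ.le]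
      have h2 := h.symm
      rw [hN2] at h2
      refine h2.vanishes (mul_ne_zero (pow_ne_zero _ hp0) (pow_ne_zero _ hq0))
        (pow_ne_zero _ hp0) hx hy hne (u := u) (by rw [hu]; push_cast; rfl) ?_
      rw [Nat.cast_mul]
      refine (isCoprime_pow_of_not_dvd hp hpu _).mul_right (isCoprime_pow_of_not_dvd hq ?_ _)
      intro hqu
      exact hqd (by rw [hu]; exact hqu.mul_left _)
  have hdir : ∀ x ∈ A, ∀ y ∈ A, ∀ d ∈ D, ∀ d' ∈ D, ∀ e < q, ∀ e' < q,
      ((p ^ n * q ^ 2 : ℕ) : ℤ) ∣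
        (x + ((q : ℤ) ^ 2 * d + (p : ℤ) ^ n * e)) - (y + ((q : ℤ) ^ 2 * d' + (p : ℤ) ^ n * e')) →
      x = y ∧ d = d' ∧ e = e' := by
    intro x hx y hy d hd d' hd' e he e' he' hdvd
    push_cast at hdvd
    obtain ⟨h1, h2⟩ := dvd_and_dvd_of_coprime_mul_dvd hdvd
    have hee : (q : ℤ) ∣ x - y → e = e' := by
      intro hqd
      have h3 : (q : ℤ) ∣ p ^ n * (e - e') := by
        have h4 := dvd_sub ((dvd_pow_self (q : ℤ) two_ne_zero).trans h2) hqd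
        have h5 : (q : ℤ) ∣ (q : ℤ) ^ 2 * (d - d') :=
          (dvd_pow_self (q : ℤ) two_ne_zero).mul_right _
        have h6 := dvd_sub h4 h5
        rwa [show x + ((q : ℤ) ^ 2 * d + (p : ℤ) ^ n * e) - (y + ((q : ℤ) ^ 2 * d' +
          (p : ℤ) ^ n * e')) - (x - y) - (q : ℤ) ^ 2 * (d - d') = p ^ n * (e - e') by ring] at h6
      have h4 := (hcop.symm.pow_right).dvd_of_dvd_mul_left h3
      have h5 := Int.eq_zero_of_abs_lt_dvd h4 (by rw [abs_lt]; omega)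
      omega
    have hpd : (p : ℤ) ^ n ∣ (x - y) + (q : ℤ) ^ 2 * (d - d') := by
      have h3 := dvd_sub h1 (dvd_mul_right ((p : ℤ) ^ n) (e - e'))
      rwa [show x + ((q : ℤ) ^ 2 * d + (p : ℤ) ^ n * e) - (y + ((q : ℤ) ^ 2 * d' +
          (p : ℤ) ^ n * e')) - p ^ n * (e - e') = (x - y) + (q : ℤ) ^ 2 * (d - d') by ring] at h3
    have hxy : x = y := by
      by_contra hne
      -- Exact divisibility by `q` cannot occur in a collision: it would give `e = e'`, and
      -- reduction modulo `q ^ 2` then leaves `q ^ 2 ∣ x - y`.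
      have himp : (q : ℤ) ∣ x - y → (q : ℤ) ^ 2 ∣ x - y := by
        intro hqd
        rw [hee hqd, show x + ((q : ℤ) ^ 2 * d + (p : ℤ) ^ n * e') - (y + ((q : ℤ) ^ 2 * d' +
          (p : ℤ) ^ n * e')) = (x - y) + (q : ℤ) ^ 2 * (d - d') by ring] at h2
        exact (dvd_add_left (dvd_mul_right _ _)).1 h2
      have hpn : ¬ (p : ℤ) ^ n ∣ x - y := by
        intro hpn
        refine hne (h.eq_of_dvd_left hN hx hy ?_)
        push_cast
        exact (hcop.pow).mul_dvd hpn (himp (hA x hx y hy hpn))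
      obtain ⟨δ, hδ, hex'⟩ := exists_exactPow hpn
      have hδΔ := hex x hx y hy hne δ hδ hex' himp
      have h3 := hex'.add_of_dvd hδ ((dvd_neg).2 hpd)
      rw [show x - y + -(x - y + (q : ℤ) ^ 2 * (d - d')) = (q : ℤ) ^ 2 * (d' - d) by ring] at h3
      have hdd : d' ≠ d := by
        rintro rfl
        exact h3.2 (by simp)
      obtain ⟨ε, hε, -, he2⟩ := exactPow_of_digitSet hp _ n d' hd' d hd hdd
      have := h3.unique (he2.mul_left hp (not_prime_dvd_prime_pow hp hq hpq 2))
      subst this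
      exact (mem_sdiff.1 hε).2 hδΔ
    subst hxy
    refine ⟨rfl, ?_, hee (by simp)⟩
    by_contra hdd
    obtain ⟨ε, -, hεn, he2⟩ := exactPow_of_digitSet hp _ n d hd d' hd' hdd
    rw [sub_self, zero_add] at hpd
    exact he2.not_dvd hεn (hcop.pow.dvd_of_dvd_mul_left hpd)
  have hAne : A.Nonempty := by
    rw [← card_pos, hcard]
    have := hq.pos
    have := hp.pos
    positivity
  set B : Finset ℤ := (D ×ˢ range q).image fun x => (q : ℤ) ^ 2 * x.1 + (p : ℤ) ^ n * x.2 with hB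
  have hBcard : #B = #D * q := by
    rw [hB, card_image_of_injOn, card_product, card_range]
    rintro ⟨d, e⟩ hx ⟨d', e'⟩ hy hxy
    simp only [coe_product, Set.mem_prod, mem_coe, mem_range] at hx hy hxy
    obtain ⟨x, hxA⟩ := hAne
    obtain ⟨-, rfl, rfl⟩ := hdir x hxA x hxA d hx.1 d' hy.1 e hx.2 e' hy.2 (by rw [hxy]; simp)
    rfl
  have hBdir : ∀ x ∈ A, ∀ y ∈ A, ∀ b ∈ B, ∀ b' ∈ B,
      ((p ^ n * q ^ 2 : ℕ) : ℤ) ∣ (x + b) - (y + b') → x = y ∧ b = b' := by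
    intro x hx y hy b hb b' hb' hd
    simp only [hB, mem_image, mem_product, mem_range, Prod.exists] at hb hb'
    obtain ⟨d, e, ⟨hdD, he⟩, rfl⟩ := hb
    obtain ⟨d', e', ⟨hdD', he'⟩, rfl⟩ := hb'
    obtain ⟨rfl, rfl, rfl⟩ := hdir x hx y hy d hdD d' hdD' e he e' he' hd
    exact ⟨rfl, rfl⟩
  refine ⟨B, ?_, hBdir⟩
  have hle := card_mul_card_le hN hBdir
  have hDcard : #D = p ^ (n - #Δ) := by
    rw [hD, card_digitSet hp]
    congr 1
    have := card_filter_mem_sdiff hsub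
    omega
  have hΔn : #Δ ≤ n := by simpa using card_le_card hsub
  have hΔa : #Δ ≤ a := by
    have h1 : p ^ #Δ ∣ q * p ^ a := by
      rw [← hcard, h.1]
      exact pow_card_dvd_card_of_subset hp hsub fun δ hδ => (mem_filter.1 hδ).2
    have h2 : (p ^ #Δ).Coprime q := Nat.Coprime.pow_left _ ((Nat.coprime_primes hp hq).2 hpq)
    exact (Nat.pow_dvd_pow_iff_le_right hp.one_lt).1 (h2.dvd_of_dvd_mul_left h1)
  -- Directness bounds the product of the cardinalities by `N`; the reverse bound comes from `#Δ ≤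
  -- a`.
  refine le_antisymm hle ?_
  rw [hBcard, hDcard, hcard]
  calc p ^ n * q ^ 2 = q * p ^ #Δ * (p ^ (n - #Δ) * q) := by
        rw [show q * p ^ #Δ * (p ^ (n - #Δ) * q) = p ^ (#Δ + (n - #Δ)) * q ^ 2 by
          rw [pow_add]; ring, Nat.add_sub_cancel' hΔn]
    _ ≤ q * p ^ a * (p ^ (n - #Δ) * q) := by
        gcongr
        exact hp.one_le

/-- If the spectrum `L` has a class modulo `q` inside a single class modulo `p`, then a coset of
the subgroup of order `q` in `A` prevents `A` from having elements off it at `p`-adic distance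
`n`. -/
lemma dvd_sub_of_class {p q : ℕ} (hp : p.Prime) (hq : q.Prime) (hpq : p ≠ q) {n : ℕ}
    {A L : Finset ℤ} (h : SpectralPair (p ^ (n + 1) * q ^ 2) A L) {a₀ : ℤ}
    (hfib : ∀ t : ℤ, ∃ a ∈ A,
      ((p ^ (n + 1) * q ^ 2 : ℕ) : ℤ) ∣ a - (a₀ + t * ((p ^ (n + 1) * q : ℕ) : ℤ)))
    {b d : ℤ} (hb : b ∈ A) (hbp : (p : ℤ) ^ n ∣ a₀ - b)
    (hd : ∀ l ∈ L, (q : ℤ) ∣ l - d → (p : ℤ) ∣ l - d) (hcnt : ¬ q ∣ cnt L q d) :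
    (q : ℤ) ∣ a₀ - b := by
  by_contra hqb
  have hp0 := hp.ne_zero
  have hq0 := hq.ne_zero
  have hcop := isCoprime_primes hp hq hpq
  set N := p ^ (n + 1) * q ^ 2 with hNdef
  have hN : N ≠ 0 := mul_ne_zero (pow_ne_zero _ hp0) (pow_ne_zero _ hq0)
  have hNQ : N = q * (p ^ (n + 1) * q) := by rw [hNdef]; ring
  -- Orthogonality of `b` to each point of the coset of `a₀`, which avoids `b` since `q` does not
  -- divide `a₀ - b`.
  have h1 : ∀ t : ℕ, ∑ l ∈ L, chr N ((a₀ - b) * l) * chr q (t * l) = 0 := by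
    intro t
    obtain ⟨a, ha, hat⟩ := hfib t
    have hne : a ≠ b := by
      rintro rfl
      apply hqb
      have h2 : (q : ℤ) ∣ a - (a₀ + t * ((p ^ (n + 1) * q : ℕ) : ℤ)) := by
        refine dvd_trans ?_ hat
        rw [hNQ]
        push_cast
        exact dvd_mul_right _ _
      have h3 : (q : ℤ) ∣ t * ((p ^ (n + 1) * q : ℕ) : ℤ) := by
        push_cast
        exact (dvd_mul_left _ _).mul_left _
      have h4 := dvd_add h2 h3
      rw [show a - (a₀ + t * ((p ^ (n + 1) * q : ℕ) : ℤ)) + t * ((p ^ (n + 1) * q : ℕ) : ℤ)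
        = -(a₀ - a) by ring] at h4
      exact (dvd_neg).1 h4
    rw [← h.symm.2 a ha b hb hne]
    refine sum_congr rfl fun l _ => ?_
    have h5 : chr q (t * l) = chr N (t * ((p ^ (n + 1) * q : ℕ) : ℤ) * l) := by
      rw [hNQ, ← chr_mul_right (M := q) (K := p ^ (n + 1) * q)
        (mul_ne_zero (pow_ne_zero _ hp0) hq0)]
      congr 1
      ring
    rw [h5, ← chr_add]
    apply chr_congr hN
    have h6 := (hat.mul_right (-l))
    rwa [show (a - (a₀ + t * ((p ^ (n + 1) * q : ℕ) : ℤ))) * -l =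
      (a₀ - b) * l + t * ((p ^ (n + 1) * q : ℕ) : ℤ) * l - (a - b) * l by ring] at h6
  -- Fourier inversion over `t` modulo `q` isolates the class of `d`.
  have h2 : ∑ l ∈ L with (q : ℤ) ∣ l - d, chr N ((a₀ - b) * l) = 0 := by
    have h3 : ∑ t ∈ range q, chr q (-(t * d)) * ∑ l ∈ L, chr N ((a₀ - b) * l) * chr q (t * l) = 0 :=
      sum_eq_zero fun t _ => by rw [h1, mul_zero]
    simp_rw [mul_sum] at h3
    rw [sum_comm] at h3
    have h4 : ∀ l ∈ L, ∑ t ∈ range q, chr q (-(t * d)) * (chr N ((a₀ - b) * l) * chr q (t * l)) =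
        (q : ℂ) * if (q : ℤ) ∣ l - d then chr N ((a₀ - b) * l) else 0 := by
      intro l _
      have h5 : ∀ t : ℕ, chr q (-(t * d)) * (chr N ((a₀ - b) * l) * chr q (t * l)) =
          chr N ((a₀ - b) * l) * chr q (t * (l - d)) := by
        intro t
        rw [mul_left_comm, ← chr_add]
        ring_nf
      simp_rw [h5]
      rw [← mul_sum, sum_range_chr hq0]
      split_ifs
      · ring
      · ring
    rw [sum_congr rfl h4, ← mul_sum] at h3
    rw [sum_filter]
    exact (mul_eq_zero.1 h3).resolve_left (by exact_mod_cast hq0)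
  have hpqd : ∀ l ∈ L, (q : ℤ) ∣ l - d → ((p : ℤ) * q) * ((l - d) / (p * q)) = l - d :=
    fun l hl hld => Int.mul_ediv_cancel' (hcop.mul_dvd (hd l hl hld) hld)
  obtain ⟨s, hs⟩ := hbp
  have hqs : ¬ (q : ℤ) ∣ s := fun hqs => hqb (by rw [hs]; exact hqs.mul_left _)
  set C := ({l ∈ L | (q : ℤ) ∣ l - d}).image fun l => (l - d) / ((p : ℤ) * q) with hC
  have hinj : Set.InjOn (fun l => (l - d) / ((p : ℤ) * q))
      ({l ∈ L | (q : ℤ) ∣ l - d} : Finset ℤ) := by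
    intro x hx y hy hxy
    rw [mem_coe, mem_filter] at hx hy
    have h3 := hpqd x hx.1 hx.2
    have h4 := hpqd y hy.1 hy.2
    simp only at hxy
    rw [hxy, h4] at h3
    linarith
  -- With `a₀ - b = p ^ n * s` and `l - d = p * q * x`, the product is `N / q` times `s * x`, so the
  -- sum over the class is, up to a unit factor, a sum of `q`-th roots of unity.
  have h3 : Vanishes C q := by
    rw [vanishes_iff_mul hq0 (isCoprime_prime_of_not_dvd hq hqs), hC, sum_image hinj]
    have h4 : ∀ l ∈ ({l ∈ L | (q : ℤ) ∣ l - d} : Finset ℤ), chr q (s * ((l - d) / ((p : ℤ) * q))) =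
        chr N (-((a₀ - b) * d)) * chr N ((a₀ - b) * l) := by
      intro l hl
      rw [mem_filter] at hl
      have h5 := hpqd l hl.1 hl.2
      rw [← chr_add, hNQ, ← chr_mul_right (M := q) (K := p ^ (n + 1) * q)
        (mul_ne_zero (pow_ne_zero _ hp0) hq0)]
      congr 1
      push_cast
      rw [hs]
      linear_combination (p : ℤ) ^ n * s * h5
    rw [sum_congr rfl h4, ← mul_sum, h2, mul_zero]
  apply hcnt
  have h4 : cnt L q d = #C := (card_image_of_injOn hinj).symm
  rw [h4, card_eq_mul_cnt hq h3 0]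
  exact dvd_mul_right _ _

/-- The case in which neither `A` nor its spectrum admits a reduction to a smaller group. -/
lemma exists_tilePair_of_fiber {p q : ℕ} (hp : p.Prime) (hq : q.Prime) (hpq : p ≠ q) {n : ℕ}
    {A L : Finset ℤ} (h : SpectralPair (p ^ (n + 1) * q ^ 2) A L) (hq2 : ¬ q ^ 2 ∣ #A)
    (hLp : Vanishes L p) (hLq : Vanishes L q) {a₀ k : ℤ} (ha₀ : a₀ ∈ A)
    (hfib : ∀ t : ℤ, ∃ a ∈ A,
      ((p ^ (n + 1) * q ^ 2 : ℕ) : ℤ) ∣ a - (a₀ + t * ((p ^ (n + 1) * q : ℕ) : ℤ)))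
    (hmiss : ∀ t : ℤ, ∀ a ∈ A, ¬ ((p ^ (n + 1) * q ^ 2 : ℕ) : ℤ) ∣
      a - (a₀ + k * ((p ^ n * q ^ 2 : ℕ) : ℤ) + t * ((p ^ (n + 1) * q : ℕ) : ℤ))) :
    ∃ B, TilePair (p ^ (n + 1) * q ^ 2) A B := by
  classical
  have hp0 := hp.ne_zero
  have hq0 := hq.ne_zero
  have hcop := isCoprime_primes hp hq hpq
  have hN : p ^ (n + 1) * q ^ 2 ≠ 0 := mul_ne_zero (pow_ne_zero _ hp0) (pow_ne_zero _ hq0)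
  have hL : ∀ d, #A = q * cnt L q d := fun d => by rw [h.1]; exact card_eq_mul_cnt hq hLq d
  have hqc : ∀ d, ¬ q ∣ cnt L q d := by
    intro d hd
    apply hq2
    rw [hL d, pow_two]
    exact mul_dvd_mul_left _ hd
  have hLq2 : ¬ Vanishes L (q ^ 2) := by
    intro hv
    apply hqc 0
    have := cnt_eq_mul_of_vanishes hq (i := 1) hv 0
    rw [pow_one] at this
    rw [this]
    exact dvd_mul_right _ _
  -- A difference divisible by `p ^ (n + 1)` but not by `q` has order `q ^ 2`, and `L` would vanish
  -- there.
  have hgraph : ∀ x ∈ A, ∀ y ∈ A, (p : ℤ) ^ (n + 1) ∣ x - y → (q : ℤ) ∣ x - y := by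
    intro x hx y hy hd
    by_contra hqd
    apply hLq2
    obtain ⟨u, hu⟩ := hd
    have h2 := h.symm
    rw [mul_comm] at h2
    refine h2.vanishes (pow_ne_zero _ hq0) (pow_ne_zero _ hp0) hx hy ?_ (u := u)
      (by rw [hu]; push_cast; rfl) (isCoprime_pow_of_not_dvd hq ?_ _)
    · rintro rfl
      exact hqd (by simp)
    · intro hqu
      exact hqd (by rw [hu]; exact hqu.mul_left _)
  have hmissq : ∀ a ∈ A,
      ¬ (((p ^ (n + 1) * q : ℕ) : ℤ) ∣ a - (a₀ + k * ((p ^ n * q ^ 2 : ℕ) : ℤ))) := by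
    rintro a ha ⟨t, ht⟩
    refine hmiss t a ha ?_
    rw [show a - (a₀ + k * ((p ^ n * q ^ 2 : ℕ) : ℤ) + t * ((p ^ (n + 1) * q : ℕ) : ℤ)) = 0 by
      linear_combination ht]
    exact dvd_zero _
  -- Modulo `p ^ (n + 1) * q` the class of `a₀` is occupied and its translate by `k * p ^ n * q ^ 2`
  -- is empty, so the grid relation would produce a point congruent to `a₀` modulo `p ^ (n + 1)` but
  -- not modulo `q`, against `hgraph`.
  have hAv : ¬ Vanishes A (p ^ (n + 1) * q) := by
    intro hv
    have hM0 : p ^ (n + 1) * q ≠ 0 := mul_ne_zero (pow_ne_zero _ hp0) hq0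
    have h1 := cnt_grid_of_vanishes (p := p) (q := q) (P := p ^ n * q) (Q := p ^ (n + 1)) hM0
      (by ring) (by ring) (fun l h1 h2 => Nat.Coprime.mul_right
        (Nat.Coprime.pow_right _ ((Nat.Prime.coprime_iff_not_dvd hp).2 h1).symm)
        ((Nat.Prime.coprime_iff_not_dvd hq).2 h2).symm) hv a₀ (k * q) 1
    have h2 : cnt A (p ^ (n + 1) * q) (a₀ + k * q * (p ^ n * q : ℕ)) = 0 := by
      by_contra h0
      obtain ⟨a, ha, hd⟩ := cnt_pos.1 (Nat.pos_of_ne_zero h0)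
      refine hmissq a ha ?_
      rwa [show a₀ + k * ((p ^ n * q ^ 2 : ℕ) : ℤ) = a₀ + k * q * (p ^ n * q : ℕ) by
        push_cast; ring]
    have h3 := cnt_self_pos ha₀ (p ^ (n + 1) * q)
    obtain ⟨a, ha, hd⟩ := cnt_pos.1
      (show 0 < cnt A (p ^ (n + 1) * q) (a₀ + 1 * (p ^ (n + 1) : ℕ)) by omega)
    push_cast at hd
    obtain ⟨h4, h5⟩ := dvd_and_dvd_of_coprime_mul_dvd hd
    have h6 : (p : ℤ) ^ (n + 1) ∣ a - a₀ := by
      have := dvd_add h4 (dvd_refl ((p : ℤ) ^ (n + 1)))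
      rwa [show a - (a₀ + 1 * (p : ℤ) ^ (n + 1)) + p ^ (n + 1) = a - a₀ by ring] at this
    have h7 := dvd_sub (hgraph a ha a₀ ha₀ h6) h5
    rw [show a - a₀ - (a - (a₀ + 1 * (p : ℤ) ^ (n + 1))) = p ^ (n + 1) by ring] at h7
    exact not_prime_dvd_prime_pow hq hp hpq.symm _ h7
  -- Otherwise the difference has order exactly `p ^ (n + 1) * q`, excluded by `hAv`.
  have hclass : ∀ l ∈ L, ∀ l' ∈ L, (q : ℤ) ∣ l - l' → ¬ (p : ℤ) ∣ l - l' →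
      (q : ℤ) ^ 2 ∣ l - l' := by
    intro l hl l' hl' hqd hpd
    by_contra hq2d
    apply hAv
    obtain ⟨u, hu⟩ := hqd
    have h2 := h
    rw [show p ^ (n + 1) * q ^ 2 = p ^ (n + 1) * q * q by ring] at h2
    refine h2.vanishes (mul_ne_zero (pow_ne_zero _ hp0) hq0) hq0 hl hl' ?_ hu ?_
    · rintro rfl
      exact hpd (by simp)
    · rw [Nat.cast_mul]
      refine (isCoprime_pow_of_not_dvd hp ?_ _).mul_right (isCoprime_prime_of_not_dvd hq ?_)
      · exact fun hpu => hpd (by rw [hu]; exact hpu.mul_left _)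
      · exact fun hqu => hq2d (by rw [hu, pow_two]; exact mul_dvd_mul_left _ hqu)
  have hpos : 0 < #A := card_pos.2 ⟨a₀, ha₀⟩
  have hLne : L.Nonempty := by rw [← card_pos, ← h.1]; exact hpos
  obtain ⟨l₁, hl₁, l₂, hl₂, hl12, hl12p⟩ : ∃ l₁ ∈ L, ∃ l₂ ∈ L,
      (q : ℤ) ∣ l₁ - l₂ ∧ ¬ (p : ℤ) ∣ l₁ - l₂ := by
    -- If each class of `L` modulo `q` sat inside one class modulo `p`, a class modulo `p` would be
    -- a union of classes modulo `q`, all of equal size. Comparing the two equidistributions gives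
    -- `p ∣ q`.
    by_contra! hcon
    obtain ⟨l₀, hl₀⟩ := hLne
    have h1 : #A = p * cnt L p l₀ := by rw [h.1]; exact card_eq_mul_cnt hp hLp l₀
    have h2 : cnt L q 0 ∣ cnt L p l₀ := by
      have h3 := card_eq_sum_cnt (A := {l ∈ L | (p : ℤ) ∣ l - l₀}) hq0
      change cnt L p l₀ = _ at h3
      rw [h3]
      refine dvd_sum fun d _ => ?_
      by_cases h4 : ∃ l ∈ L, (p : ℤ) ∣ l - l₀ ∧ (q : ℤ) ∣ l - d
      · obtain ⟨l, hl, hlp, hlq⟩ := h4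
        have h5 : cnt {l ∈ L | (p : ℤ) ∣ l - l₀} q d = cnt L q d := by
          unfold cnt
          rw [filter_filter]
          congr 1
          refine filter_congr fun x hx => ⟨fun h => h.2, fun h6 => ⟨?_, h6⟩⟩
          have h7 : (q : ℤ) ∣ x - l := by
            have := dvd_sub h6 hlq
            rwa [sub_sub_sub_cancel_right] at this
          have h8 := dvd_add (hcon x hx l hl h7) hlp
          rwa [sub_add_sub_cancel] at h8
        rw [h5]
        have h9 := hL d
        rw [hL 0] at h9
        exact dvd_of_eq (Nat.eq_of_mul_eq_mul_left hq.pos h9)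
      · have h5 : cnt {l ∈ L | (p : ℤ) ∣ l - l₀} q d = 0 := by
          by_contra h6
          obtain ⟨l, hl, hlq⟩ := cnt_pos.1 (Nat.pos_of_ne_zero h6)
          rw [mem_filter] at hl
          exact h4 ⟨l, hl.1, hl.2, hlq⟩
        rw [h5]
        exact dvd_zero _
    obtain ⟨g, hg⟩ := h2
    have hc0 : 0 < cnt L q 0 := by
      rcases Nat.eq_zero_or_pos (cnt L q 0) with h0 | h0
      · exact absurd (h0 ▸ dvd_zero q) (hqc 0)
      · exact h0
    have h3 : q = p * g := by
      rw [hL 0, hg] at h1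
      refine Nat.eq_of_mul_eq_mul_right hc0 ?_
      rw [h1]; ring
    exact hpq ((Nat.prime_dvd_prime_iff_eq hp hq).1 ⟨g, h3⟩)
  have hAn : Vanishes A (p ^ (n + 1)) := by
    obtain ⟨u, hu⟩ := hclass l₁ hl₁ l₂ hl₂ hl12 hl12p
    refine h.vanishes (pow_ne_zero _ hp0) (pow_ne_zero _ hq0) hl₁ hl₂ ?_ (u := u)
      (by rw [hu]; push_cast; rfl) (isCoprime_pow_of_not_dvd hp ?_ _)
    · rintro rfl
      exact hl12p (by simp)
    · exact fun hpu => hl12p (by rw [hu]; exact hpu.mul_left _)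
  -- Equidistribution at `p ^ (n + 1)` supplies a point with the `p`-part of the missing coset; it
  -- cannot also have its `q`-part, so it differs from `a₀` modulo `q`.
  obtain ⟨b, hb, hbd⟩ : ∃ b ∈ A, ((p ^ (n + 1) : ℕ) : ℤ) ∣ b - (a₀ + k * q ^ 2 * p ^ n) := by
    apply cnt_pos.1
    rw [cnt_shift_of_vanishes_prime_pow hp hAn]
    exact cnt_self_pos ha₀ _
  have hbq : ¬ (q : ℤ) ∣ a₀ - b := by
    intro hqd
    refine hmissq b hb ?_
    push_cast at hbd ⊢
    refine (hcop.pow_left).mul_dvd ?_ ?_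
    · rwa [show a₀ + k * ((p : ℤ) ^ n * q ^ 2) = a₀ + k * q ^ 2 * p ^ n by ring]
    · rw [show b - (a₀ + k * ((p : ℤ) ^ n * q ^ 2)) = -(a₀ - b) - q * (k * p ^ n * q) by ring]
      exact dvd_sub ((dvd_neg).2 hqd) (dvd_mul_right _ _)
  have hbp : (p : ℤ) ^ n ∣ a₀ - b := by
    have h1 : (p : ℤ) ^ n ∣ b - (a₀ + k * q ^ 2 * p ^ n) := by
      refine dvd_trans ?_ hbd
      push_cast
      exact pow_dvd_pow _ n.le_succ
    rw [show a₀ - b = -(b - (a₀ + k * q ^ 2 * p ^ n)) - p ^ n * (k * q ^ 2) by ring]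
    exact dvd_sub ((dvd_neg).2 h1) (dvd_mul_right _ _)
  have hspread : ∀ d : ℤ, ∃ l ∈ L, (q : ℤ) ∣ l - d ∧ ¬ (p : ℤ) ∣ l - d := by
    intro d
    by_contra! hcon
    exact hbq (dvd_sub_of_class hp hq hpq h hfib hb hbp hcon (hqc d))
  have hLsq : ∀ l ∈ L, ∀ l' ∈ L, (q : ℤ) ∣ l - l' → (q : ℤ) ^ 2 ∣ l - l' := by
    intro l hl l' hl' hd
    by_cases hpd : (p : ℤ) ∣ l - l'
    -- When `p` also divides the difference, pass through a third element of the same class modulo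
    -- `q` in another class modulo `p`, and use `hclass` twice.
    · obtain ⟨m, hm, hmq, hmp⟩ := hspread l
      have h1 := hclass m hm l hl hmq hmp
      have h2 : (q : ℤ) ∣ m - l' := by
        rw [← sub_add_sub_cancel m l l']
        exact dvd_add hmq hd
      have h3 : ¬ (p : ℤ) ∣ m - l' := by
        intro h3
        apply hmp
        rw [← sub_sub_sub_cancel_right m l l']
        exact dvd_sub h3 hpd
      have h4 := hclass m hm l' hl' h2 h3
      rw [← sub_sub_sub_cancel_left l' l m]
      exact dvd_sub h4 h1
    · exact hclass l hl l' hl' hd hpd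
  -- A class of `L` modulo `q` has at most `p ^ #Δ` elements, and `p ^ #Δ` divides its size because
  -- it divides `#A` and is prime to `q`.
  obtain ⟨a, ha⟩ : ∃ a, #A = q * p ^ a := by
    set Δ : Finset ℕ := {δ ∈ range (n + 1) | Vanishes A (p ^ (n + 1 - δ))} with hΔ
    refine ⟨#Δ, ?_⟩
    have hsub : Δ ⊆ range (n + 1) := filter_subset _ _
    have h1 : cnt L q 0 ≤ p ^ #Δ := by
      refine card_le_pow_of_exactPow hp fun x hx y hy hne => ?_
      rw [mem_filter] at hx hy
      have h2 : (q : ℤ) ∣ x - y := by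
        have := dvd_sub hx.2 hy.2
        rwa [sub_sub_sub_cancel_right] at this
      have h3 := hLsq x hx.1 y hy.1 h2
      have h4 : ¬ (p : ℤ) ^ (n + 1) ∣ x - y := by
        intro h4
        refine hne (h.eq_of_dvd hN hx.1 hy.1 ?_)
        push_cast
        exact (hcop.pow).mul_dvd h4 h3
      obtain ⟨δ, hδ, he⟩ := exists_exactPow h4
      refine ⟨δ, ?_, he⟩
      rw [hΔ, mem_filter, mem_range]
      exact ⟨hδ, h.vanishes_of_exactPow hp (pow_ne_zero _ hq0)
        (by push_cast; exact hcop.pow_right) hx.1 hy.1 (by push_cast; exact h3) hδ he⟩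
    have h2 : p ^ #Δ ∣ q * cnt L q 0 := by
      rw [← hL 0]
      exact pow_card_dvd_card_of_subset hp hsub fun δ hδ => (mem_filter.1 hδ).2
    have h3 : (p ^ #Δ).Coprime q := Nat.Coprime.pow_left _ ((Nat.coprime_primes hp hq).2 hpq)
    have hc0 : 0 < cnt L q 0 := by
      rcases Nat.eq_zero_or_pos (cnt L q 0) with h0 | h0
      · exact absurd (h0 ▸ dvd_zero q) (hqc 0)
      · exact h0
    rw [hL 0, le_antisymm h1 (Nat.le_of_dvd hc0 (h3.dvd_of_dvd_mul_left h2))]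
  exact exists_tilePair_of_differences hp hq hpq h ha hLsq hgraph

theorem exists_tilePair_of_spectralPair {p q : ℕ} (hp : p.Prime) (hq : q.Prime) (hpq : p ≠ q)
    {n m : ℕ} (hm : m ≤ 2) {A L : Finset ℤ} (hA : A.Nonempty)
    (h : SpectralPair (p ^ n * q ^ m) A L) : ∃ B, TilePair (p ^ n * q ^ m) A B := by
  have hp0 := hp.ne_zero
  have hq0 := hq.ne_zero
  have hcop := isCoprime_primes hp hq hpq
  induction hs : n + m generalizing n m A L with
  | zero =>
    refine exists_tilePair_of_dvd_card hp (pow_ne_zero _ hq0) (by push_cast; exact hcop.pow_right)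
      hA h ?_
    rw [show m = 0 by omega, pow_zero]
    exact one_dvd _
  | succ s ih =>
    rcases m with _ | m
    · exact exists_tilePair_of_dvd_card hp (pow_ne_zero _ hq0) (by simp [isCoprime_one_right])
        hA h (by simp)
    rcases n with _ | n
    · rw [mul_comm] at h ⊢
      exact exists_tilePair_of_dvd_card hq (pow_ne_zero _ hp0) (by simp [isCoprime_one_right])
        hA h (by simp)
    have hN : p ^ (n + 1) * q ^ (m + 1) ≠ 0 := mul_ne_zero (pow_ne_zero _ hp0) (pow_ne_zero _ hq0)
    have hNp : p ^ (n + 1) * q ^ (m + 1) = p ^ n * q ^ (m + 1) * p := by ring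
    have hNq : p ^ (n + 1) * q ^ (m + 1) = p ^ (n + 1) * q ^ m * q := by ring
    have hMp : p ^ n * q ^ (m + 1) ≠ 0 := mul_ne_zero (pow_ne_zero _ hp0) (pow_ne_zero _ hq0)
    have hMq : p ^ (n + 1) * q ^ m ≠ 0 := mul_ne_zero (pow_ne_zero _ hp0) (pow_ne_zero _ hq0)
    have ihp : ∀ A' L' : Finset ℤ, A'.Nonempty → SpectralPair (p ^ n * q ^ (m + 1)) A' L' →
        ∃ B, TilePair (p ^ n * q ^ (m + 1)) A' B := fun A' L' hA' h' => ih hm hA' h' (by omega)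
    have ihq : ∀ A' L' : Finset ℤ, A'.Nonempty → SpectralPair (p ^ (n + 1) * q ^ m) A' L' →
        ∃ B, TilePair (p ^ (n + 1) * q ^ m) A' B :=
      fun A' L' hA' h' => ih (by omega) hA' h' (by omega)
    by_cases hcp : ∃ c, ∀ l ∈ L, (p : ℤ) ∣ l - c
    · obtain ⟨c, hc⟩ := hcp
      rw [hNp] at h ⊢
      exact exists_tilePair_of_spectrum_coset hMp hp0 hA h hc fun L' => ihp A L' hA
    by_cases hcq : ∃ c, ∀ l ∈ L, (q : ℤ) ∣ l - c
    · obtain ⟨c, hc⟩ := hcq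
      rw [hNq] at h ⊢
      exact exists_tilePair_of_spectrum_coset hMq hq0 hA h hc fun L' => ihq A L' hA
    by_cases hpp : ∀ a ∈ A, ∀ k : ℤ, ∃ a' ∈ A,
        ((p ^ (n + 1) * q ^ (m + 1) : ℕ) : ℤ) ∣ a' - (a + k * ((p ^ n * q ^ (m + 1) : ℕ) : ℤ))
    · rw [hNp] at h hpp ⊢
      exact exists_tilePair_of_periodic hMp hp0 hA h hpp ihp
    by_cases hpq' : ∀ a ∈ A, ∀ k : ℤ, ∃ a' ∈ A,
        ((p ^ (n + 1) * q ^ (m + 1) : ℕ) : ℤ) ∣ a' - (a + k * ((p ^ (n + 1) * q ^ m : ℕ) : ℤ))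
    · rw [hNq] at h hpq' ⊢
      exact exists_tilePair_of_periodic hMq hq0 hA h hpq' ihq
    by_cases hdvd : q ^ (m + 1) ∣ #A
    · exact exists_tilePair_of_dvd_card hp (pow_ne_zero _ hq0)
        (by push_cast; exact hcop.pow_right) hA h hdvd
    have hAN : Vanishes A (p ^ (n + 1) * q ^ (m + 1)) := by
      obtain ⟨l, hl, l', hl', h1, h2⟩ := exists_not_dvd_not_dvd hcp hcq
      have h3 := h
      rw [← mul_one (p ^ (n + 1) * q ^ (m + 1))] at h3
      refine h3.vanishes hN one_ne_zero hl hl' ?_ (u := l - l') (by simp) ?_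
      · rintro rfl
        exact h1 (by simp)
      · rw [Nat.cast_mul]
        exact (isCoprime_pow_of_not_dvd hp h1 _).mul_right (isCoprime_pow_of_not_dvd hq h2 _)
    have hc : ∀ l : ℕ, ¬ p ∣ l → ¬ q ∣ l → l.Coprime (p ^ (n + 1) * q ^ (m + 1)) :=
      fun l h1 h2 => Nat.Coprime.mul_right
        (Nat.Coprime.pow_right _ ((Nat.Prime.coprime_iff_not_dvd hp).2 h1).symm)
        (Nat.Coprime.pow_right _ ((Nat.Prime.coprime_iff_not_dvd hq).2 h2).symm)
    have hinj : ∀ a ∈ A, ∀ a' ∈ A, ((p ^ (n + 1) * q ^ (m + 1) : ℕ) : ℤ) ∣ a - a' → a = a' :=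
      fun a ha a' ha' => h.eq_of_dvd_left hN ha ha'
    -- Two neighbours in a coset of the subgroup of order `r` differ by `M * (1 + r * t)`, of order
    -- `r`, so duality makes `L` vanish at `r`.
    have hfiber : ∀ {r M : ℕ}, r.Prime → M ≠ 0 → p ^ (n + 1) * q ^ (m + 1) = r * M →
        ∀ a ∈ A, (∀ t : ℤ, ∃ a' ∈ A, ((p ^ (n + 1) * q ^ (m + 1) : ℕ) : ℤ) ∣
          a' - (a + t * (M : ℤ))) → Vanishes L r := by
      intro r M hr hM hrM a ha hfib
      obtain ⟨a', ha', hd⟩ := hfib 1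
      have h3 := h.symm
      rw [hrM] at h3
      rw [hrM] at hd
      push_cast at hd
      obtain ⟨t, ht⟩ := hd
      have h4 : a' - a = M * (1 + r * t) := by linear_combination ht
      have hr2 : ¬ (r : ℤ) ∣ 1 + r * t := by
        intro h5
        have h6 := (dvd_add_left (dvd_mul_right (r : ℤ) t)).1 h5
        exact (Nat.prime_iff_prime_int.1 hr).not_isUnit (isUnit_of_dvd_one h6)
      refine h3.vanishes hr.ne_zero hM ha' ha ?_ h4 (isCoprime_prime_of_not_dvd hr hr2)
      rintro rfl
      rw [sub_self, eq_comm, mul_eq_zero] at h4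
      rcases h4 with h4 | h4
      · exact hM (by exact_mod_cast h4)
      · exact hr2 (by rw [h4]; exact dvd_zero _)
    obtain ⟨a₀, ha₀, k, hfib, hmiss⟩ := exists_fiber_of_not_periodic hN
      (hNp.trans (mul_comm _ _)) (hNq.trans (mul_comm _ _)) hc hinj hAN hpp
    obtain ⟨a₁, ha₁, -, hfib', -⟩ := exists_fiber_of_not_periodic hN
      (hNq.trans (mul_comm _ _)) (hNp.trans (mul_comm _ _)) (fun l h1 h2 => hc l h2 h1) hinj hAN
      hpq'
    have hLq := hfiber hq hMq (hNq.trans (mul_comm _ _)) a₀ ha₀ hfib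
    have hLp := hfiber hp hMp (hNp.trans (mul_comm _ _)) a₁ ha₁ hfib'
    -- The only use of `m ≤ 2`. With exponent 1, equidistribution of `L` modulo `q` contradicts
    -- `hdvd`.
    obtain rfl | rfl : m = 0 ∨ m = 1 := by omega
    · refine absurd ?_ hdvd
      rw [zero_add, pow_one, h.1, card_eq_mul_cnt hq hLq 0]
      exact dvd_mul_right _ _
    · simp only [Nat.reduceAdd, pow_one] at *
      exact exists_tilePair_of_fiber hp hq hpq h hdvd hLp hLq ha₀ hfib hmiss

/-! ### Tilings: cyclotomic divisors and cardinalities -/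

lemma TilePair.ne_zero_nonempty {N : ℕ} (hN : N ≠ 0) {A B : Finset ℤ} (h : TilePair N A B) :
    A.Nonempty := by
  rw [nonempty_iff_ne_empty]
  rintro rfl
  exact hN (by rw [← h.1]; simp)

/-- The sums `a + b` form a complete residue system, whose exponential sum vanishes at every order
`d > 1` dividing the modulus and factors as a product over `A` and `B`. -/
lemma TilePair.vanishes_or {d K : ℕ} (hd : d ≠ 0) (hd1 : d ≠ 1) (hK : K ≠ 0) {A B : Finset ℤ}
    (h : TilePair (d * K) A B) : Vanishes A d ∨ Vanishes B d := by
  have hN : d * K ≠ 0 := mul_ne_zero hd hK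
  have hinj : Set.InjOn (fun x : ℤ × ℤ => x.1 + x.2) (A ×ˢ B : Finset (ℤ × ℤ)) := by
    rintro ⟨a, b⟩ hx ⟨a', b'⟩ hy hxy
    simp only [coe_product, Set.mem_prod, mem_coe] at hx hy hxy
    obtain ⟨rfl, rfl⟩ := h.2 a hx.1 a' hy.1 b hx.2 b' hy.2 (by rw [hxy]; simp)
    rfl
  set C := (A ×ˢ B).image fun x => x.1 + x.2 with hC
  have hle : ∀ r, cnt C (d * K) r ≤ 1 := by
    intro r
    refine card_le_one.2 fun x hx y hy => ?_
    rw [mem_filter] at hx hy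
    obtain ⟨⟨a, b⟩, hab, rfl⟩ := mem_image.1 hx.1
    obtain ⟨⟨a', b'⟩, hab', rfl⟩ := mem_image.1 hy.1
    rw [mem_product] at hab hab'
    have h1 := dvd_sub hx.2 hy.2
    rw [sub_sub_sub_cancel_right] at h1
    obtain ⟨h2, h3⟩ := h.2 a hab.1 a' hab'.1 b hab.2 b' hab'.2 h1
    rw [h2, h3]
  have hone : ∀ r, cnt C (d * K) r = 1 := by
    intro r
    have h1 := cnt_eq_sum (A := C) one_ne_zero hN r
    have h2 : cnt C 1 r = ∑ _k ∈ range (d * K), 1 := by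
      have h3 : cnt C 1 r = #C := by simp [cnt]
      rw [h3, hC, card_image_of_injOn hinj, card_product, h.1]
      simp
    rw [h2, one_mul, eq_comm] at h1
    have h3 := (sum_eq_sum_iff_of_le fun k _ => hle _).1 h1 0
      (mem_range.2 (Nat.pos_of_ne_zero hN))
    simpa using h3
  have hv : Vanishes C d := vanishes_of_cnt_shift (M := d * K) (P := 1) hN (dvd_mul_right _ _)
    (by simpa using hd1) fun r => by rw [hone, hone]
  rw [Vanishes, hC, sum_image hinj, sum_product] at hv
  simp_rw [chr_add, ← mul_sum] at hv
  rw [← sum_mul] at hv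
  exact mul_eq_zero.1 hv

open Classical in
/-- The places `δ < n` such that the mask polynomial of `A` is divisible by the cyclotomic
polynomial of order `p ^ (n - δ)`. -/
noncomputable def places (p n : ℕ) (A : Finset ℤ) : Finset ℕ :=
  {δ ∈ range n | Vanishes A (p ^ (n - δ))}

lemma mem_places {p n : ℕ} {A : Finset ℤ} {δ : ℕ} :
    δ ∈ places p n A ↔ δ < n ∧ Vanishes A (p ^ (n - δ)) := by
  classical
  rw [places, mem_filter, mem_range]

lemma places_subset (p n : ℕ) (A : Finset ℤ) : places p n A ⊆ range n := fun _ h =>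
  mem_range.2 (mem_places.1 h).1

lemma pow_card_places_dvd {p : ℕ} (hp : p.Prime) (n : ℕ) (A : Finset ℤ) :
    p ^ #(places p n A) ∣ #A :=
  pow_card_dvd_card_of_subset hp (places_subset p n A) fun _ h => (mem_places.1 h).2

lemma TilePair.places_union {p : ℕ} (hp : p.Prime) {n Q : ℕ} (hQ : Q ≠ 0) {A B : Finset ℤ}
    (h : TilePair (p ^ n * Q) A B) : places p n A ∪ places p n B = range n := by
  refine Subset.antisymm (union_subset (places_subset _ _ _) (places_subset _ _ _)) fun δ hδ => ?_
  rw [mem_range] at hδ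
  have hN : p ^ n * Q = p ^ (n - δ) * (p ^ δ * Q) := by
    rw [← mul_assoc, ← pow_add, Nat.sub_add_cancel hδ.le]
  rw [hN] at h
  have h1 : p ^ (n - δ) ≠ 1 := (Nat.one_lt_pow (by omega) hp.one_lt).ne'
  rw [mem_union, mem_places, mem_places]
  rcases h.vanishes_or (pow_ne_zero _ hp.ne_zero) h1
    (mul_ne_zero (pow_ne_zero _ hp.ne_zero) hQ) with h2 | h2
  · exact Or.inl ⟨hδ, h2⟩
  · exact Or.inr ⟨hδ, h2⟩

lemma TilePair.card_places_add {p : ℕ} (hp : p.Prime) {n Q : ℕ} (hQ : Q ≠ 0) (hpQ : p.Coprime Q)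
    {A B : Finset ℤ} (h : TilePair (p ^ n * Q) A B) :
    #(places p n A) + #(places p n B) = n := by
  refine le_antisymm ?_ ?_
  · have h1 : p ^ (#(places p n A) + #(places p n B)) ∣ p ^ n * Q := by
      rw [← h.1, pow_add]
      exact mul_dvd_mul (pow_card_places_dvd hp n A) (pow_card_places_dvd hp n B)
    exact (Nat.pow_dvd_pow_iff_le_right hp.one_lt).1
      ((Nat.Coprime.pow_left _ hpQ).dvd_of_dvd_mul_right h1)
  · have := card_union_le (places p n A) (places p n B)
    rwa [h.places_union hp hQ, card_range] at this

/-- The two sets of places cover `range n` and their sizes add up to `n`, so they are disjoint. -/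
lemma TilePair.not_vanishes {p : ℕ} (hp : p.Prime) {n Q : ℕ} (hQ : Q ≠ 0) (hpQ : p.Coprime Q)
    {A B : Finset ℤ} (h : TilePair (p ^ n * Q) A B) {i : ℕ} (hi : i < n)
    (hA : Vanishes A (p ^ (i + 1))) : ¬ Vanishes B (p ^ (i + 1)) := by
  intro hB
  have h1 := h.card_places_add hp hQ hpQ
  have h2 := card_union_add_card_inter (places p n A) (places p n B)
  rw [h.places_union hp hQ, card_range, h1] at h2
  have h3 : places p n A ∩ places p n B = ∅ := card_eq_zero.1 (by omega)
  have h4 : n - 1 - i ∈ places p n A ∩ places p n B := by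
    rw [mem_inter, mem_places, mem_places, show n - (n - 1 - i) = i + 1 by omega]
    exact ⟨⟨by omega, hA⟩, ⟨by omega, hB⟩⟩
  rw [h3] at h4
  simp at h4

/-- For `A` and for `B` the product of prime powers is a lower bound for the cardinality, and the
two bounds multiply to `N = #A * #B`. -/
lemma TilePair.card_eq {p q : ℕ} (hp : p.Prime) (hq : q.Prime) (hpq : p ≠ q) {n m : ℕ}
    {A B : Finset ℤ} (h : TilePair (p ^ n * q ^ m) A B) :
    #A = p ^ #(places p n A) * q ^ #(places q m A) := by
  have hpos : 0 < p ^ n * q ^ m := Nat.mul_pos (pow_pos hp.pos _) (pow_pos hq.pos _)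
  have hc := (Nat.coprime_primes hp hq).2 hpq
  have h1 := h.card_places_add hp (pow_ne_zero _ hq.ne_zero) (hc.pow_right _)
  have h2 : #(places q m A) + #(places q m B) = m := by
    rw [mul_comm] at h
    exact h.card_places_add hq (pow_ne_zero _ hp.ne_zero) (hc.symm.pow_right _)
  have hAB := h.1
  have hA0 : 0 < #A := Nat.pos_of_ne_zero fun h0 => by rw [h0, zero_mul] at hAB; omega
  have hB0 : 0 < #B := Nat.pos_of_ne_zero fun h0 => by rw [h0, mul_zero] at hAB; omega
  have hle : ∀ C : Finset ℤ, 0 < #C → p ^ #(places p n C) * q ^ #(places q m C) ≤ #C :=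
    fun C hC => Nat.le_of_dvd hC (Nat.Coprime.mul_dvd_of_dvd_of_dvd (Nat.Coprime.pow _ _ hc)
      (pow_card_places_dvd hp n C) (pow_card_places_dvd hq m C))
  refine le_antisymm ?_ (hle A hA0)
  have h3 : #A * #B = p ^ #(places p n A) * q ^ #(places q m A) *
      (p ^ #(places p n B) * q ^ #(places q m B)) := by
    rw [hAB, mul_mul_mul_comm, ← pow_add, ← pow_add, h1, h2]
  by_contra! hlt
  have h4 := Nat.mul_lt_mul_of_lt_of_le hlt (hle B hB0) (by positivity)
  omega

/-- Dilating one factor by `r` prime to `N` keeps the tiling: at each nonzero frequency, of some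
order `d > 1`, one factor vanishes, and dilation does not affect vanishing at `d`. Only the zero
frequency contributes to the count. -/
lemma TilePair.card_representations {N : ℕ} (hN : N ≠ 0) {A B : Finset ℤ} (h : TilePair N A B)
    {r : ℤ} (hr : IsCoprime r N) (z : ℤ) :
    #{x ∈ A ×ˢ B | (N : ℤ) ∣ r * x.1 + x.2 - z} = 1 := by
  have hN' : (N : ℂ) ≠ 0 := Nat.cast_ne_zero.2 hN
  have h1 : ∑ l ∈ range N, ∑ x ∈ A ×ˢ B, chr N (l * (r * x.1 + x.2 - z)) = N := by
    have h2 : ∀ l ∈ range N, l ≠ 0 → ∑ x ∈ A ×ˢ B, chr N (l * (r * x.1 + x.2 - z)) = 0 := by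
      intro l hl hl0
      rw [mem_range] at hl
      have h3 : ∑ x ∈ A ×ˢ B, chr N (l * (r * x.1 + x.2 - z)) =
          chr N (-(l * z)) * ((∑ a ∈ A, chr N (l * r * a)) * ∑ b ∈ B, chr N (l * b)) := by
        rw [sum_mul_sum, ← sum_product', mul_sum]
        refine sum_congr rfl fun x _ => ?_
        rw [← chr_add, ← chr_add]
        ring_nf
      rw [h3]
      obtain ⟨d, hd⟩ := Nat.gcd_dvd_right l N
      obtain ⟨u, hu⟩ := Nat.gcd_dvd_left l N
      have hg0 : 0 < l.gcd N := Nat.gcd_pos_of_pos_left _ (Nat.pos_of_ne_zero hl0)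
      have hud : u.Coprime d := by
        have := Nat.coprime_div_gcd_div_gcd hg0
        rwa [Nat.div_eq_of_eq_mul_right hg0 hu, Nat.div_eq_of_eq_mul_right hg0 hd] at this
      set g := l.gcd N
      rw [mul_comm] at hd
      have hd0 : d ≠ 0 := by
        rintro rfl
        exact hN (by rw [hd, zero_mul])
      have hd1 : d ≠ 1 := by
        rintro rfl
        rw [one_mul] at hd
        rw [← hd] at hu
        have : N ≤ l := Nat.le_of_dvd (Nat.pos_of_ne_zero hl0) ⟨u, hu⟩
        omega
      have huc : IsCoprime (u : ℤ) d := Nat.isCoprime_iff_coprime.2 hud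
      have hrc : IsCoprime r d := hr.of_isCoprime_of_dvd_right ⟨g, by rw [hd]; push_cast; ring⟩
      rw [hd] at h ⊢
      rcases h.vanishes_or hd0 hd1 hg0.ne' with h4 | h4
      · rw [(vanishes_factor_iff hd0 hg0.ne' (x := l * r) (u := u * r)
          (by rw [hu]; push_cast; ring) (huc.mul_left hrc)).1 h4]
        ring
      · rw [(vanishes_factor_iff hd0 hg0.ne' (x := l) (u := u)
          (by rw [hu]; push_cast; ring) huc).1 h4]
        ring
    rw [sum_eq_single_of_mem 0 (mem_range.2 (Nat.pos_of_ne_zero hN)) h2]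
    simp only [Nat.cast_zero, zero_mul, chr_zero, sum_const, card_product, h.1]
    simp
  rw [sum_comm] at h1
  simp_rw [sum_range_chr hN] at h1
  rw [← sum_filter, sum_const, nsmul_eq_mul] at h1
  have h2 := mul_right_cancel₀ hN' (h1.trans (one_mul (N : ℂ)).symm)
  exact_mod_cast h2

/-- Otherwise both `A` and `B` have differences prime to `N`. A dilation prime to `N` then carries
`a - a'` to `b' - b`, giving one element two representations. -/
lemma TilePair.coset {p q : ℕ} (hp : p.Prime) (hq : q.Prime) {n m : ℕ}
    {A B : Finset ℤ} (h : TilePair (p ^ n * q ^ m) A B) :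
    (∃ c, ∀ a ∈ A, (p : ℤ) ∣ a - c) ∨ (∃ c, ∀ a ∈ A, (q : ℤ) ∣ a - c) ∨
    (∃ c, ∀ b ∈ B, (p : ℤ) ∣ b - c) ∨ ∃ c, ∀ b ∈ B, (q : ℤ) ∣ b - c := by
  by_contra! hcon
  obtain ⟨h1, h2, h3, h4⟩ := hcon
  obtain ⟨a, ha, a', ha', hap, haq⟩ := exists_not_dvd_not_dvd (L := A) (p := p) (q := q)
    (by push Not; exact h1) (by push Not; exact h2)
  obtain ⟨b, hb, b', hb', hbp, hbq⟩ := exists_not_dvd_not_dvd (L := B) (p := p) (q := q)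
    (by push Not; exact h3) (by push Not; exact h4)
  have hN : p ^ n * q ^ m ≠ 0 :=
    mul_ne_zero (pow_ne_zero _ hp.ne_zero) (pow_ne_zero _ hq.ne_zero)
  have hc : ∀ x : ℤ, ¬ (p : ℤ) ∣ x → ¬ (q : ℤ) ∣ x → IsCoprime x ((p ^ n * q ^ m : ℕ) : ℤ) := by
    intro x hxp hxq
    rw [Nat.cast_mul]
    exact (isCoprime_pow_of_not_dvd hp hxp _).mul_right (isCoprime_pow_of_not_dvd hq hxq _)
  obtain ⟨s, t, hst⟩ := hc _ hap haq
  have hsc : IsCoprime s ((p ^ n * q ^ m : ℕ) : ℤ) := ⟨a - a', t, by linear_combination hst⟩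
  have hbc : IsCoprime (b' - b) ((p ^ n * q ^ m : ℕ) : ℤ) := by
    rw [← neg_sub]
    exact (hc _ hbp hbq).neg_left
  -- `s` inverts `a - a'` modulo `N`.
  have h5 := h.card_representations hN (r := s * (b' - b)) (hsc.mul_left hbc)
    (s * (b' - b) * a + b)
  rw [card_eq_one] at h5
  obtain ⟨x, hx⟩ := h5
  have h6 : (a, b) = x := by
    rw [← mem_singleton, ← hx, mem_filter, mem_product]
    exact ⟨⟨ha, hb⟩, by simp⟩
  have h7 : (a', b') = x := by
    rw [← mem_singleton, ← hx, mem_filter, mem_product]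
    refine ⟨⟨ha', hb'⟩, (b' - b) * t, ?_⟩
    linear_combination -(b' - b) * hst
  rw [← h7, Prod.mk.injEq] at h6
  exact hap (by rw [h6.1]; simp)

/-! ### Contraction of a residue class and the product condition -/

/-- The preimage of `F` under `x ↦ c + p * x`, for `F` inside the residue class of `c`. -/
def contract (p : ℕ) (c : ℤ) (F : Finset ℤ) : Finset ℤ := F.image fun a => (a - c) / (p : ℤ)

section Contract

variable {p : ℕ} {c : ℤ} {F : Finset ℤ}

lemma mul_div_of_class (hF : ∀ a ∈ F, (p : ℤ) ∣ a - c) {a : ℤ} (ha : a ∈ F) :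
    p * ((a - c) / (p : ℤ)) = a - c := Int.mul_ediv_cancel' (hF a ha)

lemma injOn_contract (hF : ∀ a ∈ F, (p : ℤ) ∣ a - c) :
    Set.InjOn (fun a => (a - c) / (p : ℤ)) F := by
  intro x hx y hy hxy
  have h1 := mul_div_of_class hF hx
  have h2 := mul_div_of_class hF hy
  simp only at hxy
  rw [hxy, h2] at h1
  linarith

lemma card_contract (hF : ∀ a ∈ F, (p : ℤ) ∣ a - c) : #(contract p c F) = #F :=
  card_image_of_injOn (injOn_contract hF)

lemma mem_contract (hF : ∀ a ∈ F, (p : ℤ) ∣ a - c) {x : ℤ} (hx : x ∈ contract p c F) :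
    c + p * x ∈ F := by
  obtain ⟨a, ha, rfl⟩ := mem_image.1 hx
  rw [mul_div_of_class hF ha]
  simpa using ha

lemma sum_chr_contract (hF : ∀ a ∈ F, (p : ℤ) ∣ a - c) (d : ℕ) :
    ∑ a ∈ F, chr d a = chr d c * ∑ x ∈ contract p c F, chr d (p * x) := by
  rw [contract, sum_image (injOn_contract hF), mul_sum]
  refine sum_congr rfl fun a ha => ?_
  rw [mul_div_of_class hF ha, ← chr_add]
  ring_nf

lemma vanishes_mul_iff_contract (hp : p ≠ 0) (hF : ∀ a ∈ F, (p : ℤ) ∣ a - c) (d : ℕ) :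
    Vanishes F (d * p) ↔ Vanishes (contract p c F) d := by
  rw [Vanishes, sum_chr_contract hF, mul_eq_zero, or_iff_right (chr_ne_zero _ _), Vanishes]
  simp_rw [chr_mul_right hp]

lemma vanishes_iff_contract (hF : ∀ a ∈ F, (p : ℤ) ∣ a - c) {d : ℕ} (hd : d ≠ 0)
    (hc : IsCoprime (p : ℤ) d) : Vanishes F d ↔ Vanishes (contract p c F) d := by
  rw [Vanishes, sum_chr_contract hF, mul_eq_zero, or_iff_right (chr_ne_zero _ _),
    vanishes_iff_mul hd hc]

lemma not_vanishes_of_class (hp : p ≠ 0) (hF : ∀ a ∈ F, (p : ℤ) ∣ a - c) (hne : F.Nonempty) :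
    ¬ Vanishes F p := by
  have h1 := vanishes_mul_iff_contract hp hF 1
  rw [one_mul] at h1
  rw [h1, Vanishes, sum_congr rfl fun x _ => (chr_eq_one_iff one_ne_zero x).2 (by simp)]
  have : #(contract p c F) ≠ 0 := by
    rw [card_contract hF]
    exact hne.card_pos.ne'
  simpa using this

end Contract

/-- Each slice gives a direct sum, so its product of cardinalities is at most `M`; over the `p`
slices these products add up to `p * M`, so all are equalities. -/
lemma TilePair.contract {p M : ℕ} (hp : p ≠ 0) (hM : M ≠ 0) {A B : Finset ℤ} {c : ℤ}
    (h : TilePair (M * p) A B) (hA : ∀ a ∈ A, (p : ℤ) ∣ a - c) {k : ℕ} (hk : k < p) :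
    TilePair M (contract p c A) (contract p k {b ∈ B | (p : ℤ) ∣ b - k}) := by
  have hB : ∀ k : ℕ, ∀ b ∈ ({b ∈ B | (p : ℤ) ∣ b - k} : Finset ℤ), (p : ℤ) ∣ b - k :=
    fun k b hb => (mem_filter.1 hb).2
  have hp' : (p : ℤ) ≠ 0 := by exact_mod_cast hp
  have hdir : ∀ k : ℕ, ∀ x ∈ Fuglede.contract p c A, ∀ x' ∈ Fuglede.contract p c A,
      ∀ y ∈ Fuglede.contract p k {b ∈ B | (p : ℤ) ∣ b - k},
      ∀ y' ∈ Fuglede.contract p k {b ∈ B | (p : ℤ) ∣ b - k},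
      (M : ℤ) ∣ (x + y) - (x' + y') → x = x' ∧ y = y' := by
    intro k x hx x' hx' y hy y' hy' hd
    obtain ⟨h1, h2⟩ := h.2 _ (mem_contract hA hx) _ (mem_contract hA hx')
      _ (mem_filter.1 (mem_contract (hB k) hy)).1 _ (mem_filter.1 (mem_contract (hB k) hy')).1 (by
        obtain ⟨t, ht⟩ := hd
        exact ⟨t, by push_cast; linear_combination p * ht⟩)
    exact ⟨mul_left_cancel₀ hp' (by linarith), mul_left_cancel₀ hp' (by linarith)⟩
  have hle := fun k => card_mul_card_le hM (hdir k)
  refine ⟨?_, hdir k⟩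
  have h1 : ∑ k ∈ range p, #(Fuglede.contract p c A) *
      #(Fuglede.contract p k {b ∈ B | (p : ℤ) ∣ b - k}) = ∑ _k ∈ range p, M := by
    rw [← mul_sum, card_contract hA, sum_congr rfl fun k _ => card_contract (hB k)]
    have h2 := card_eq_sum_cnt (A := B) hp
    unfold cnt at h2
    rw [← h2, h.1, sum_const, card_range, smul_eq_mul, mul_comm]
  exact (sum_eq_sum_iff_of_le fun k _ => hle k).1 h1 k (mem_range.2 hk)

/-- The second Coven–Meyerowitz condition, for two primes. -/
def CondT2 (p q n m : ℕ) (A : Finset ℤ) : Prop :=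
  ∀ i < n, ∀ j < m, Vanishes A (p ^ (i + 1)) → Vanishes A (q ^ (j + 1)) →
    Vanishes A (p ^ (i + 1) * q ^ (j + 1))

lemma CondT2.swap {p q n m : ℕ} {A : Finset ℤ} (h : CondT2 p q n m A) : CondT2 q p m n A := by
  intro i hi j hj h1 h2
  rw [mul_comm]
  exact h j hj i hi h2 h1

/-- Contraction lowers the power of `p` by one. For `A` the exponent 1 never occurs, since a
nonempty set in one class modulo `p` cannot vanish at `p`. For `B` each slice is treated alone: `A`
does not vanish where `B` does, so neither does the contracted `A` at the matching order, and the
slice, its partner in a tiling, must. -/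
lemma TilePair.condT2_of_coset {p q : ℕ} (hp : p.Prime) (hq : q.Prime) (hpq : p ≠ q) {n m : ℕ}
    {A B : Finset ℤ} (h : TilePair (p ^ (n + 1) * q ^ m) A B) {c : ℤ}
    (hA : ∀ a ∈ A, (p : ℤ) ∣ a - c)
    (ih : ∀ A' B', TilePair (p ^ n * q ^ m) A' B' → CondT2 p q n m A') :
    CondT2 p q (n + 1) m A ∧ CondT2 p q (n + 1) m B := by
  have hp0 := hp.ne_zero
  have hq0 := hq.ne_zero
  have hM : p ^ n * q ^ m ≠ 0 := mul_ne_zero (pow_ne_zero _ hp0) (pow_ne_zero _ hq0)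
  have hN : p ^ (n + 1) * q ^ m = p ^ n * q ^ m * p := by ring
  have hAne : A.Nonempty := h.ne_zero_nonempty (by rw [hN]; exact mul_ne_zero hM hp0)
  have hcop := (Nat.coprime_primes hp hq).2 hpq
  have hcq : ∀ j, IsCoprime (p : ℤ) ((q ^ j : ℕ) : ℤ) := fun j =>
    Nat.isCoprime_iff_coprime.2 (hcop.pow_right _)
  have h' := h
  rw [hN] at h'
  have hk := fun k (hk : k < p) => h'.contract hp0 hM hA hk
  refine ⟨?_, ?_⟩
  · intro i hi j hj h1 h2
    rcases i with _ | i
    · exact absurd (by simpa using h1) (not_vanishes_of_class hp0 hA hAne)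
    have h3 : p ^ (i + 1 + 1) * q ^ (j + 1) = p ^ (i + 1) * q ^ (j + 1) * p := by ring
    rw [h3, vanishes_mul_iff_contract hp0 hA]
    rw [pow_succ, vanishes_mul_iff_contract hp0 hA] at h1
    rw [vanishes_iff_contract hA (pow_ne_zero _ hq0) (hcq _)] at h2
    exact ih _ _ (hk 0 hp.pos) i (by omega) j hj h1 h2
  · intro i hi j hj h1 h2
    rw [Vanishes, sum_fiberwise_mod hp0]
    refine sum_eq_zero fun k hkp => ?_
    have hkp := mem_range.1 hkp
    have hB : ∀ b ∈ ({b ∈ B | (p : ℤ) ∣ b - k} : Finset ℤ), (p : ℤ) ∣ b - k :=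
      fun b hb => (mem_filter.1 hb).2
    change Vanishes {b ∈ B | (p : ℤ) ∣ b - k} _
    have h3 : p ^ (i + 1) * q ^ (j + 1) = p ^ i * q ^ (j + 1) * p := by ring
    rw [h3, vanishes_mul_iff_contract hp0 hB]
    have hkt := hk k hkp
    have h4 : Vanishes (Fuglede.contract p k {b ∈ B | (p : ℤ) ∣ b - k}) (q ^ (j + 1)) := by
      have h5 : ¬ Vanishes A (q ^ (j + 1)) := by
        intro h6
        rw [mul_comm] at h
        exact h.not_vanishes hq (pow_ne_zero _ hp0) (hcop.symm.pow_right _) hj h6 h2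
      rw [vanishes_iff_contract hA (pow_ne_zero _ hq0) (hcq _)] at h5
      have h6 : p ^ n * q ^ m = q ^ (j + 1) * (q ^ (m - (j + 1)) * p ^ n) := by
        rw [← mul_assoc, ← pow_add, Nat.add_sub_cancel' hj, mul_comm]
      rw [h6] at hkt
      exact (hkt.vanishes_or (pow_ne_zero _ hq0) (Nat.one_lt_pow (by omega) hq.one_lt).ne'
        (mul_ne_zero (pow_ne_zero _ hq0) (pow_ne_zero _ hp0))).resolve_left h5
    -- For exponent 1 no power of `p` survives contraction and the goal is `h4` itself.
    rcases i with _ | i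
    · simpa using h4
    refine ih _ _ hkt.symm i (by omega) j hj ?_ h4
    have h5 : ¬ Vanishes A (p ^ (i + 1 + 1)) := fun h6 =>
      h.not_vanishes hp (pow_ne_zero _ hq0) (hcop.pow_right _) hi h6 h1
    rw [pow_succ, vanishes_mul_iff_contract hp0 hA] at h5
    have h6 : p ^ n * q ^ m = p ^ (i + 1) * (p ^ (n - (i + 1)) * q ^ m) := by
      rw [← mul_assoc, ← pow_add, Nat.add_sub_cancel' (by omega)]
    rw [h6] at hkt
    exact (hkt.vanishes_or (pow_ne_zero _ hp0) (Nat.one_lt_pow (by omega) hp.one_lt).ne'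
      (mul_ne_zero (pow_ne_zero _ hp0) (pow_ne_zero _ hq0))).resolve_left h5

lemma TilePair.condT2 {p q : ℕ} (hp : p.Prime) (hq : q.Prime) (hpq : p ≠ q) {n m : ℕ}
    {A B : Finset ℤ} (h : TilePair (p ^ n * q ^ m) A B) : CondT2 p q n m A := by
  induction hs : n + m generalizing n m A B with
  | zero =>
    intro i hi
    omega
  | succ s ih =>
    rcases n with _ | n
    · intro i hi
      omega
    rcases m with _ | m
    · intro i _ j hj
      omega
    have ihp : ∀ A' B', TilePair (p ^ n * q ^ (m + 1)) A' B' → CondT2 p q n (m + 1) A' :=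
      fun A' B' h' => ih h' (by omega)
    have ihq : ∀ A' B', TilePair (q ^ m * p ^ (n + 1)) A' B' → CondT2 q p m (n + 1) A' := by
      intro A' B' h'
      rw [mul_comm] at h'
      exact (ih h' (by omega)).swap
    have h2 := h
    rw [mul_comm] at h2
    rcases h.coset hp hq with ⟨c, hc⟩ | ⟨c, hc⟩ | ⟨c, hc⟩ | ⟨c, hc⟩
    · exact (h.condT2_of_coset hp hq hpq hc ihp).1
    · exact (h2.condT2_of_coset hq hp hpq.symm hc ihq).1.swap
    · exact (h.symm.condT2_of_coset hp hq hpq hc ihp).2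
    · exact (h2.symm.condT2_of_coset hq hp hpq.symm hc ihq).2.swap

/-- The spectrum consists of `q ^ m * u + p ^ n * v` with digits of `u` and `v` only at the places
of `A`. Its size is right by `TilePair.card_eq`. A difference has order `p ^ (n - δ)`, `q ^ (m - ε)`
or their product, with `δ` and `ε` places of `A`; the product case is what `CondT2` covers. -/
theorem TilePair.exists_spectralPair {p q : ℕ} (hp : p.Prime) (hq : q.Prime) (hpq : p ≠ q)
    {n m : ℕ} {A B : Finset ℤ} (h : TilePair (p ^ n * q ^ m) A B) :
    ∃ L, SpectralPair (p ^ n * q ^ m) A L := by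
  have hp0 := hp.ne_zero
  have hq0 := hq.ne_zero
  have hcop := isCoprime_primes hp hq hpq
  have hT2 := h.condT2 hp hq hpq
  set U := digitSet p (places p n A) n with hU
  set V := digitSet q (places q m A) m with hV
  have hinj : ∀ u ∈ U, ∀ u' ∈ U, ∀ v ∈ V, ∀ v' ∈ V,
      (q : ℤ) ^ m * u + (p : ℤ) ^ n * v = q ^ m * u' + p ^ n * v' → u = u' ∧ v = v' := by
    intro u hu u' hu' v hv v' hv' heq
    have h1 : (p : ℤ) ^ n ∣ q ^ m * (u - u') := ⟨v' - v, by linear_combination heq⟩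
    have h2 : (q : ℤ) ^ m ∣ p ^ n * (v - v') := ⟨u' - u, by linear_combination heq⟩
    refine ⟨?_, ?_⟩
    · by_contra hne
      obtain ⟨δ, -, hδ, he⟩ := exactPow_of_digitSet hp _ n u hu u' hu' hne
      exact he.not_dvd hδ (hcop.pow.dvd_of_dvd_mul_left h1)
    · by_contra hne
      obtain ⟨δ, -, hδ, he⟩ := exactPow_of_digitSet hq _ m v hv v' hv' hne
      exact he.not_dvd hδ (hcop.symm.pow.dvd_of_dvd_mul_left h2)
  refine ⟨(U ×ˢ V).image fun x => (q : ℤ) ^ m * x.1 + (p : ℤ) ^ n * x.2, ?_, ?_⟩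
  · have hc : ∀ {r k : ℕ}, #{δ ∈ range k | δ ∈ places r k A} = #(places r k A) := by
      intro r k
      rw [filter_mem_eq_inter, inter_eq_right.2 (places_subset r k A)]
    rw [card_image_of_injOn, card_product, hU, hV, card_digitSet hp, card_digitSet hq, hc, hc]
    · exact h.card_eq hp hq hpq
    · rintro ⟨u, v⟩ hx ⟨u', v'⟩ hy hxy
      simp only [coe_product, Set.mem_prod, mem_coe] at hx hy hxy
      obtain ⟨rfl, rfl⟩ := hinj u hx.1 u' hy.1 v hx.2 v' hy.2 hxy
      rfl
  · intro l hl l' hl' hne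
    simp only [mem_image, mem_product, Prod.exists] at hl hl'
    obtain ⟨u, v, ⟨hu, hv⟩, rfl⟩ := hl
    obtain ⟨u', v', ⟨hu', hv'⟩, rfl⟩ := hl'
    by_cases huu : u = u'
    · subst huu
      have hvv : v ≠ v' := by
        rintro rfl
        exact hne rfl
      obtain ⟨ε, hεA, hε, he⟩ := exactPow_of_digitSet hq _ m v hv v' hv' hvv
      obtain ⟨w, hw, hqw⟩ := he.eq_mul
      have hN : p ^ n * q ^ m = q ^ (m - ε) * (q ^ ε * p ^ n) := by
        rw [← mul_assoc, ← pow_add, Nat.sub_add_cancel hε.le, mul_comm]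
      rw [hN]
      refine (vanishes_factor_iff (pow_ne_zero _ hq0)
        (mul_ne_zero (pow_ne_zero _ hq0) (pow_ne_zero _ hp0)) (u := w) ?_
        (isCoprime_pow_of_not_dvd hq hqw _)).1 (mem_places.1 hεA).2
      push_cast
      linear_combination (p : ℤ) ^ n * hw
    obtain ⟨δ, hδA, hδ, hd⟩ := exactPow_of_digitSet hp _ n u hu u' hu' huu
    obtain ⟨w, hw, hpw⟩ := hd.eq_mul
    by_cases hvv : v = v'
    · subst hvv
      have hN : p ^ n * q ^ m = p ^ (n - δ) * (p ^ δ * q ^ m) := by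
        rw [← mul_assoc, ← pow_add, Nat.sub_add_cancel hδ.le]
      rw [hN]
      refine (vanishes_factor_iff (pow_ne_zero _ hp0)
        (mul_ne_zero (pow_ne_zero _ hp0) (pow_ne_zero _ hq0)) (u := w) ?_
        (isCoprime_pow_of_not_dvd hp hpw _)).1 (mem_places.1 hδA).2
      push_cast
      linear_combination (q : ℤ) ^ m * hw
    obtain ⟨ε, hεA, hε, he⟩ := exactPow_of_digitSet hq _ m v hv v' hv' hvv
    obtain ⟨z, hz, hqz⟩ := he.eq_mul
    obtain ⟨s, hs⟩ : ∃ s, n - δ = s + 1 := ⟨n - δ - 1, by omega⟩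
    obtain ⟨t, ht⟩ : ∃ t, m - ε = t + 1 := ⟨m - ε - 1, by omega⟩
    have hn : n = δ + (s + 1) := by omega
    have hm : m = ε + (t + 1) := by omega
    have hN : p ^ n * q ^ m = p ^ (s + 1) * q ^ (t + 1) * (p ^ δ * q ^ ε) := by
      rw [hn, hm]
      ring
    have hv1 : Vanishes A (p ^ (s + 1) * q ^ (t + 1)) := by
      refine hT2 s (by omega) t (by omega) ?_ ?_
      · rw [← hs]
        exact (mem_places.1 hδA).2
      · rw [← ht]
        exact (mem_places.1 hεA).2
    rw [hN]
    refine (vanishes_factor_iff (mul_ne_zero (pow_ne_zero _ hp0) (pow_ne_zero _ hq0))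
      (mul_ne_zero (pow_ne_zero _ hp0) (pow_ne_zero _ hq0))
      (u := q ^ (t + 1) * w + p ^ (s + 1) * z) ?_ ?_).1 hv1
    · have hn' : (p : ℤ) ^ n = p ^ δ * p ^ (s + 1) := by rw [hn, pow_add]
      have hm' : (q : ℤ) ^ m = q ^ ε * q ^ (t + 1) := by rw [hm, pow_add]
      push_cast
      rw [hn', hm']
      linear_combination (q : ℤ) ^ ε * q ^ (t + 1) * hw + (p : ℤ) ^ δ * p ^ (s + 1) * hz
    · rw [Nat.cast_mul]
      refine (isCoprime_pow_of_not_dvd hp ?_ _).mul_right (isCoprime_pow_of_not_dvd hq ?_ _)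
      · intro hd
        have h1 : (p : ℤ) ∣ p ^ (s + 1) * z := (dvd_pow_self _ s.succ_ne_zero).mul_right _
        have h2 := (dvd_add_left h1).1 hd
        exact hpw (hcop.pow_right.dvd_of_dvd_mul_left h2)
      · intro hd
        have h1 : (q : ℤ) ∣ q ^ (t + 1) * w := (dvd_pow_self _ t.succ_ne_zero).mul_right _
        have h2 := (dvd_add_right h1).1 hd
        exact hqz (hcop.symm.pow_right.dvd_of_dvd_mul_left h2)

/-! ### Passage between ℤ/N and integer representatives -/

section Lift

variable {N : ℕ} [NeZero N]

/-- The least nonnegative representatives of the elements of `S`. -/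
def lift (S : Finset (ZMod N)) : Finset ℤ := S.image fun x => (x.val : ℤ)

lemma injective_val_cast : Function.Injective fun x : ZMod N => (x.val : ℤ) :=
  fun _ _ h => ZMod.val_injective N (Nat.cast_injective h)

lemma card_lift (S : Finset (ZMod N)) : #(lift S) = #S :=
  card_image_of_injective _ injective_val_cast

lemma mem_lift {S : Finset (ZMod N)} {a : ℤ} : a ∈ lift S ↔ ∃ x ∈ S, (x.val : ℤ) = a := by
  simp [lift]

lemma stdAddChar_intCast (k : ℤ) : (ZMod.stdAddChar (k : ZMod N) : ℂ) = chr N k := by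
  rw [ZMod.stdAddChar_coe, chr]

lemma sum_lift (S : Finset (ZMod N)) (k : ℤ) :
    ∑ a ∈ lift S, chr N (k * a) = ∑ x ∈ S, (ZMod.stdAddChar ((k : ZMod N) * x) : ℂ) := by
  rw [lift, sum_image injective_val_cast.injOn]
  refine sum_congr rfl fun x _ => ?_
  rw [← stdAddChar_intCast]
  simp

lemma linearIndependent_expOn {S Λ : Finset (ZMod N)} (hS : S.Nonempty)
    (h : ∀ l ∈ Λ, ∀ l' ∈ Λ, l ≠ l' → ∑ x ∈ S, (ZMod.stdAddChar ((l - l') * x) : ℂ) = 0) :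
    LinearIndependent ℂ fun l : Λ => expOn S (l : ZMod N) := by
  rw [Fintype.linearIndependent_iff]
  intro g hg l'
  have h1 : ∑ x : S, (∑ l : Λ, g l • expOn S (l : ZMod N)) x *
      (ZMod.stdAddChar (-(l' : ZMod N) * (x : ZMod N)) : ℂ) = 0 := by
    rw [hg]
    simp
  have h2 : ∀ x : S, (∑ l : Λ, g l • expOn S (l : ZMod N)) x *
      (ZMod.stdAddChar (-(l' : ZMod N) * (x : ZMod N)) : ℂ) =
      ∑ l : Λ, g l * (ZMod.stdAddChar (((l : ZMod N) - (l' : ZMod N)) * (x : ZMod N)) : ℂ) := by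
    intro x
    rw [Finset.sum_apply, sum_mul]
    refine sum_congr rfl fun l _ => ?_
    rw [Pi.smul_apply, smul_eq_mul, expOn, mul_assoc, ← AddChar.map_add_eq_mul]
    ring_nf
  simp_rw [h2] at h1
  rw [sum_comm] at h1
  simp_rw [← mul_sum] at h1
  rw [sum_eq_single_of_mem l' (mem_univ _)] at h1
  · have h3 : ∑ x : S,
        (ZMod.stdAddChar (((l' : ZMod N) - (l' : ZMod N)) * (x : ZMod N)) : ℂ) ≠ 0 := by
      simp [hS.ne_empty]
    exact (mul_eq_zero.1 h1).resolve_right h3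
  · intro l _ hne
    rw [sum_coe_sort S fun x => (ZMod.stdAddChar (((l : ZMod N) - (l' : ZMod N)) * x) : ℂ),
      h l l.2 l' l'.2 (fun h => hne (Subtype.ext h)), mul_zero]

/-- Orthogonal exponentials on a nonempty set are independent, so spanning all functions on `S`
amounts to `#Λ = #S`. -/
lemma isSpectral_iff {S : Finset (ZMod N)} (hS : S.Nonempty) :
    IsSpectral S ↔ ∃ L, SpectralPair N (lift S) L := by
  have hrange : ∀ Λ : Finset (ZMod N),
      Set.range (fun l : Λ => expOn S (l : ZMod N)) = expOn S '' (Λ : Set (ZMod N)) := by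
    intro Λ
    rw [Set.image_eq_range]
    rfl
  constructor
  · rintro ⟨Λ, hspan, horth⟩
    have h1 := finrank_span_eq_card (linearIndependent_expOn hS horth)
    rw [hrange, hspan, finrank_top, Module.finrank_fintype_fun_eq_card, Fintype.card_coe,
      Fintype.card_coe] at h1
    refine ⟨lift Λ, by rw [card_lift, card_lift, h1], ?_⟩
    intro l hl l' hl' hne
    obtain ⟨x, hx, rfl⟩ := mem_lift.1 hl
    obtain ⟨y, hy, rfl⟩ := mem_lift.1 hl'
    rw [sum_lift]
    push_cast
    rw [ZMod.natCast_zmod_val, ZMod.natCast_zmod_val]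
    exact horth x hx y hy fun h => hne (by rw [h])
  · rintro ⟨L, hL⟩
    set Λ : Finset (ZMod N) := L.image Int.cast with hΛ
    have horth : ∀ l ∈ Λ, ∀ l' ∈ Λ, l ≠ l' →
        ∑ x ∈ S, (ZMod.stdAddChar ((l - l') * x) : ℂ) = 0 := by
      intro l hl l' hl' hne
      obtain ⟨x, hx, rfl⟩ := mem_image.1 hl
      obtain ⟨y, hy, rfl⟩ := mem_image.1 hl'
      rw [← Int.cast_sub, ← sum_lift]
      exact hL.2 x hx y hy fun h => hne (by rw [h])
    have hcard : #Λ = #S := by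
      rw [hΛ, card_image_of_injOn, ← hL.1, card_lift]
      intro x hx y hy hxy
      exact hL.eq_of_dvd (NeZero.ne N) hx hy
        ((ZMod.intCast_eq_intCast_iff_dvd_sub _ _ _).1 hxy.symm)
    refine ⟨Λ, ?_, horth⟩
    have : Nonempty Λ := by
      rw [nonempty_coe_sort, ← card_pos, hcard]
      exact hS.card_pos
    rw [← hrange]
    refine (linearIndependent_expOn hS horth).span_eq_top_of_card_eq_finrank ?_
    rw [Module.finrank_fintype_fun_eq_card, Fintype.card_coe, Fintype.card_coe, hcard]

lemma tiles_iff {S : Finset (ZMod N)} :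
    Tiles (S : Set (ZMod N)) ↔ ∃ B, TilePair N (lift S) B := by
  classical
  constructor
  · rintro ⟨T, hT⟩
    set T' : Finset (ZMod N) := {t | t ∈ T} with hT'
    have hmem : ∀ t, t ∈ T' ↔ t ∈ T := by simp [hT']
    have huniq : ∀ s ∈ S, ∀ s' ∈ S, ∀ t ∈ T', ∀ t' ∈ T', s + t = s' + t' → s = s' ∧ t = t' := by
      intro s hs s' hs' t ht t' ht' heq
      have h1 := (hT (s + t)).unique (y₁ := (s, t)) (y₂ := (s', t')) ⟨hs, (hmem t).1 ht, rfl⟩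
        ⟨hs', (hmem t').1 ht', heq.symm⟩
      exact Prod.mk.inj h1
    refine ⟨lift T', ?_, ?_⟩
    · have h1 : #(S ×ˢ T') = #(univ : Finset (ZMod N)) := by
        refine card_nbij (fun x => x.1 + x.2) (fun _ _ => mem_univ _) ?_ ?_
        · rintro ⟨s, t⟩ hx ⟨s', t'⟩ hy hxy
          simp only [coe_product, Set.mem_prod, mem_coe] at hx hy hxy
          obtain ⟨rfl, rfl⟩ := huniq s hx.1 s' hy.1 t hx.2 t' hy.2 hxy
          rfl
        · intro g _
          obtain ⟨⟨s, t⟩, ⟨hs, ht, hst⟩, -⟩ := hT g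
          exact ⟨(s, t), by simpa using ⟨hs, (hmem t).2 ht⟩, hst⟩
      rw [card_lift, card_lift, ← card_product, h1, card_univ, ZMod.card]
    · intro a ha a' ha' b hb b' hb' hd
      obtain ⟨s, hs, rfl⟩ := mem_lift.1 ha
      obtain ⟨s', hs', rfl⟩ := mem_lift.1 ha'
      obtain ⟨t, ht, rfl⟩ := mem_lift.1 hb
      obtain ⟨t', ht', rfl⟩ := mem_lift.1 hb'
      have h1 := (ZMod.intCast_eq_intCast_iff_dvd_sub _ _ _).2 hd
      push_cast at h1
      simp only [ZMod.natCast_zmod_val] at h1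
      obtain ⟨rfl, rfl⟩ := huniq s' hs' s hs t' ht' t ht h1
      exact ⟨rfl, rfl⟩
  · rintro ⟨B, hB⟩
    refine ⟨(Int.cast : ℤ → ZMod N) '' B, fun g => ?_⟩
    have huniq : ∀ s ∈ S, ∀ s' ∈ S, ∀ b ∈ B, ∀ b' ∈ B, s + (b : ZMod N) = s' + (b' : ZMod N) →
        s = s' ∧ b = b' := by
      intro s hs s' hs' b hb b' hb' heq
      have h1 : (((s'.val : ℤ) + b' : ℤ) : ZMod N) = (((s.val : ℤ) + b : ℤ) : ZMod N) := by
        push_cast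
        rw [ZMod.natCast_zmod_val, ZMod.natCast_zmod_val, heq]
      obtain ⟨h2, h3⟩ := hB.2 _ (mem_lift.2 ⟨s, hs, rfl⟩) _ (mem_lift.2 ⟨s', hs', rfl⟩) b hb b' hb'
        ((ZMod.intCast_eq_intCast_iff_dvd_sub _ _ _).1 h1)
      exact ⟨injective_val_cast h2, h3⟩
    have himage : (S ×ˢ B).image (fun x => x.1 + (x.2 : ZMod N)) = univ := by
      apply eq_univ_of_card
      rw [card_image_of_injOn, card_product, ← card_lift, hB.1, ZMod.card]
      rintro ⟨s, b⟩ hx ⟨s', b'⟩ hy hxy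
      simp only [coe_product, Set.mem_prod, mem_coe] at hx hy hxy
      obtain ⟨rfl, rfl⟩ := huniq s hx.1 s' hy.1 b hx.2 b' hy.2 hxy
      rfl
    obtain ⟨⟨s, b⟩, hsb, hg⟩ := mem_image.1 (himage ▸ mem_univ g)
    rw [mem_product] at hsb
    refine ⟨(s, (b : ZMod N)), ⟨hsb.1, ⟨b, hsb.2, rfl⟩, hg⟩, ?_⟩
    rintro ⟨s', t'⟩ ⟨hs', ⟨b', hb', rfl⟩, hg'⟩
    obtain ⟨rfl, rfl⟩ := huniq s' hs' s hsb.1 b' hb' b hsb.2 (hg'.trans hg.symm)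
    rfl

end Lift

end Fuglede

theorem mainTheorem2 (p q n : ℕ) [Fact p.Prime] [Fact q.Prime] (hpq : p ≠ q) (hn : 1 ≤ n)
    (S : Finset (ZMod (p ^ n * q ^ 2))) (hS : S.Nonempty) :
    Fuglede.IsSpectral S ↔ Fuglede.Tiles (S : Set (ZMod (p ^ n * q ^ 2))) := by
  have hp : p.Prime := Fact.out
  have hq : q.Prime := Fact.out
  rw [Fuglede.isSpectral_iff hS, Fuglede.tiles_iff]
  constructor
  · rintro ⟨L, hL⟩
    exact Fuglede.exists_tilePair_of_spectralPair hp hq hpq le_rfl (hS.image _) hL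
  · rintro ⟨B, hB⟩
    exact hB.exists_spectralPair hp hq hpq
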